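/- All spaces are real. Let $X$ be a Banach space with dual $X'$, third dual $X'''$ and closed unit ball $B_X$, and let $F$ be a Banach lattice. A set $A\subseteq F$ is an Lwc-set if every disjoint sequence $(a_n)$ (that is, $|a_m|\wedge|a_n|=0$ for $m\ne n$) in the solid hull $\operatorname{sol}(A)=\bigcup_{a\in A}[-|a|,|a|]$ is norm-null. A bounded set $A\subseteq X$ is limited (respectively bi-limited) if every weak$^*$-null sequence in $X'$ (respectively in $X'''$, where $X\subseteq X''$ canonically) converges to $0$ uniformly on $A$. A bounded linear operator $T:X\to F$ belongs to - $\mathrm{Lwc}(X,F)$ if $T(B_X)$ is an Lwc-set; - $\text{bi-l-Lwc}(X,F)$ if $T(A)$ is an Lwc-set for every bi-limited $A\subseteq X$; - $\text{l-Lwc}(X,F)$ if $T(A)$ is an Lwc-set for every limited $A\subseteq X$; - $\mathrm{BD}(X,F)$ if $T(A)$ is relatively weakly compact for every limited $A\subseteq X$. Write $\mathcal C(E)$ for $\mathcal C(E,E)$, and $I_E$ for the identity of $E$. Let $c$ and $c_0$ be the Banach lattices of convergent and of null real sequences with the supremum norm, and $\ell^2$ that of square-summable real sequences, all ordered coordinatewise.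 Then: 1. For every Banach space $X$ and every Banach lattice $F$, $$\mathrm{Lwc}(X,F)\subseteq\text{bi-l-Lwc}(X,F)\subseteq\text{l-Lwc}(X,F)\subseteq\mathrm{BD}(X,F).$$ 2. $I_{\ell^2}\in\text{bi-l-Lwc}(\ell^2)\setminus\mathrm{Lwc}(\ell^2)$. 3. $I_{c_0}\in\text{l-Lwc}(c_0)\setminus\text{bi-l-Lwc}(c_0)$. 4. $I_{c}\in\mathrm{BD}(c)\setminus\text{l-Lwc}(c)$. 5. For $E=\ell^2\oplus c_0\oplus c$, with coordinatewise order and the maximum norm, $$\mathrm{Lwc}(E)\subsetneqq\text{bi-l-Lwc}(E)\subsetneqq\text{l-Lwc}(E)\subsetneqq\mathrm{BD}(E).$$ -/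

import Mathlib

open Filter Topology

noncomputable section

namespace LimitedlyLwc

/-- A real Banach lattice: a complete normed real vector lattice whose norm is solid. -/
class BanachLattice (E : Type*) [NormedAddCommGroup E] [NormedSpace ℝ E] [Lattice E] : Prop
    extends CompleteSpace E, HasSolidNorm E, IsOrderedAddMonoid E, IsOrderedModule ℝ E

section Sets

variable {X : Type*} [NormedAddCommGroup X] [NormedSpace ℝ X]

/-- A weak-star null sequence in the norm dual of `X`. -/
def IsWeakStarNull (f : ℕ → StrongDual ℝ X) : Prop :=
  Tendsto (fun n => StrongDual.toWeakDual (f n)) atTop (𝓝 0)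

/-- A bounded set on which every weak-star null sequence of the dual is uniformly null. -/
def IsLimited (A : Set X) : Prop :=
  Bornology.IsBounded A ∧ ∀ f : ℕ → StrongDual ℝ X, IsWeakStarNull f →
    TendstoUniformlyOn (fun n x => f n x) (fun _ => 0) atTop A

/-- A bounded set on which every weak-star null sequence of the third dual is uniformly null;
`X` acts on the third dual through the canonical embedding in its bidual. -/
def IsBiLimited (A : Set X) : Prop :=
  Bornology.IsBounded A ∧
    ∀ f : ℕ → StrongDual ℝ (StrongDual ℝ (StrongDual ℝ X)),
      IsWeakStarNull (X := StrongDual ℝ (StrongDual ℝ X)) f →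
      TendstoUniformlyOn (fun n x => f n (NormedSpace.inclusionInDoubleDual ℝ X x))
        (fun _ => 0) atTop A

/-- The weak closure of `A` is weakly compact. -/
def IsRelativelyWeaklyCompact (A : Set X) : Prop :=
  IsCompact (closure (toWeakSpace ℝ X '' A))

/-- Every disjoint sequence in the solid hull of `A` is norm null. -/
def IsLwcSet {F : Type*} [NormedAddCommGroup F] [Lattice F] (A : Set F) : Prop :=
  ∀ a : ℕ → F, (∀ n, a n ∈ LatticeOrderedAddCommGroup.solidClosure A) →
    (∀ m n, m ≠ n → |a m| ⊓ |a n| = 0) → Tendsto a atTop (𝓝 0)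

end Sets

section Operators

/-- L-weakly compact operators. -/
def Lwc (X F : Type*) [NormedAddCommGroup X] [NormedSpace ℝ X] [NormedAddCommGroup F]
    [NormedSpace ℝ F] [Lattice F] [BanachLattice F] : Set (X →L[ℝ] F) :=
  {T | IsLwcSet (T '' Metric.closedBall 0 1)}

/-- Bi-limitedly L-weakly compact operators. -/
def BiLLwc (X F : Type*) [NormedAddCommGroup X] [NormedSpace ℝ X] [NormedAddCommGroup F]
    [NormedSpace ℝ F] [Lattice F] [BanachLattice F] : Set (X →L[ℝ] F) :=
  {T | ∀ A : Set X, IsBiLimited A → IsLwcSet (T '' A)}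

/-- Limitedly L-weakly compact operators. -/
def LLwc (X F : Type*) [NormedAddCommGroup X] [NormedSpace ℝ X] [NormedAddCommGroup F]
    [NormedSpace ℝ F] [Lattice F] [BanachLattice F] : Set (X →L[ℝ] F) :=
  {T | ∀ A : Set X, IsLimited A → IsLwcSet (T '' A)}

/-- Bourgain-Diestel operators. -/
def BD (X Y : Type*) [NormedAddCommGroup X] [NormedSpace ℝ X] [NormedAddCommGroup Y]
    [NormedSpace ℝ Y] : Set (X →L[ℝ] Y) :=
  {T | ∀ A : Set X, IsLimited A → IsRelativelyWeaklyCompact (T '' A)}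

end Operators

section Spaces

/-- Square-summable real sequences. -/
abbrev EllTwo : Type := lp (fun _ : ℕ => ℝ) 2

/-- The coordinatewise order of square-summable sequences. -/
instance EllTwo.instLE : LE EllTwo := ⟨fun f g => ∀ n, f n ≤ g n⟩

instance EllTwo.instLT : LT EllTwo := ⟨fun f g => (∀ n, f n ≤ g n) ∧ ¬ ∀ n, g n ≤ f n⟩

instance EllTwo.instMax : Max EllTwo :=
  ⟨fun f g => ⟨fun n => f n ⊔ g n,
    ((lp.memℓp f).norm.add (lp.memℓp g).norm).mono fun n => by
      simp only [Pi.add_apply, Real.norm_eq_abs]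
      rcases max_choice (f n) (g n) with h | h <;> rw [h] <;>
        linarith [abs_nonneg (f n), abs_nonneg (g n)]⟩⟩

instance EllTwo.instMin : Min EllTwo :=
  ⟨fun f g => ⟨fun n => f n ⊓ g n,
    ((lp.memℓp f).norm.add (lp.memℓp g).norm).mono fun n => by
      simp only [Pi.add_apply, Real.norm_eq_abs]
      rcases min_choice (f n) (g n) with h | h <;> rw [h] <;>
        linarith [abs_nonneg (f n), abs_nonneg (g n)]⟩⟩

instance EllTwo.instLattice : Lattice EllTwo :=
  Function.Injective.lattice (fun (f : EllTwo) (n : ℕ) => f n) (fun _ _ h => lp.ext h)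
    Iff.rfl Iff.rfl (fun _ _ => rfl) (fun _ _ => rfl)

instance EllTwo.instBanachLattice : BanachLattice EllTwo where
  solid _ _ h := lp.norm_mono (by norm_num) fun n => h n
  add_le_add_left f g h k n := by
    have := h n
    simp only [lp.coeFn_add, Pi.add_apply]
    linarith
  smul_le_smul_of_nonneg_left _ hc _ _ h n := by
    simpa using mul_le_mul_of_nonneg_left (h n) hc
  smul_le_smul_of_nonneg_right _ hf _ _ h n := by
    simpa using mul_le_mul_of_nonneg_right h (hf n)

/-- Convergent real sequences, in the space of bounded sequences with the supremum norm. -/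
def convSeq : Submodule ℝ (BoundedContinuousFunction ℕ ℝ) where
  carrier := {f | ∃ l : ℝ, Tendsto f atTop (𝓝 l)}
  zero_mem' := ⟨0, tendsto_const_nhds⟩
  add_mem' := fun ⟨k, hk⟩ ⟨l, hl⟩ => ⟨k + l, hk.add hl⟩
  smul_mem' := fun c _ ⟨l, hl⟩ => ⟨c * l, hl.const_mul c⟩

/-- Null real sequences, in the space of bounded sequences with the supremum norm. -/
def nullSeq : Submodule ℝ (BoundedContinuousFunction ℕ ℝ) where
  carrier := {f | Tendsto f atTop (𝓝 0)}
  zero_mem' := tendsto_const_nhds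
  add_mem' := fun {f g} (hf : Tendsto f atTop (𝓝 0)) (hg : Tendsto g atTop (𝓝 0)) => by
    have h := hf.add hg
    rwa [add_zero] at h
  smul_mem' := fun c f (hf : Tendsto f atTop (𝓝 0)) => by
    have h := hf.const_mul c
    rwa [mul_zero] at h

/-- The space `c`. -/
abbrev SeqC : Type := convSeq

/-- The space `c₀`. -/
abbrev SeqCZero : Type := nullSeq

instance SeqC.instLattice : Lattice SeqC :=
  Subtype.lattice (fun ⦃_ _⦄ ⟨k, hk⟩ ⟨l, hl⟩ => ⟨k ⊔ l, hk.sup_nhds hl⟩)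
    (fun ⦃_ _⦄ ⟨k, hk⟩ ⟨l, hl⟩ => ⟨k ⊓ l, hk.inf_nhds hl⟩)

instance SeqCZero.instLattice : Lattice SeqCZero :=
  Subtype.lattice
    (fun ⦃f g⦄ (hf : Tendsto f atTop (𝓝 0)) (hg : Tendsto g atTop (𝓝 0)) => by
      have h := hf.sup_nhds hg
      rwa [sup_idem] at h)
    (fun ⦃f g⦄ (hf : Tendsto f atTop (𝓝 0)) (hg : Tendsto g atTop (𝓝 0)) => by
      have h := hf.inf_nhds hg
      rwa [inf_idem] at h)

theorem isClosed_convSeq : IsClosed (convSeq : Set (BoundedContinuousFunction ℕ ℝ)) := by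
  refine isClosed_of_closure_subset fun f hf => ?_
  obtain ⟨u, hu, hlim⟩ := mem_closure_iff_seq_limit.1 hf
  have hun := BoundedContinuousFunction.tendsto_iff_tendstoUniformly.1 hlim
  refine cauchySeq_tendsto_of_complete (u := f) (Metric.cauchySeq_iff.2 fun ε hε => ?_)
  obtain ⟨k, hk⟩ := (Metric.tendstoUniformly_iff.1 hun (ε / 3) (by positivity)).exists
  obtain ⟨l, hl⟩ := hu k
  obtain ⟨N, hN⟩ := Metric.cauchySeq_iff.1 hl.cauchySeq (ε / 3) (by positivity)
  refine ⟨N, fun m hm n hn => ?_⟩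
  have h1 := hk m
  have h2 := hk n
  have h3 := hN m hm n hn
  rw [dist_comm] at h2
  linarith [dist_triangle4 (f m) (u k m) (u k n) (f n)]

theorem isClosed_nullSeq : IsClosed (nullSeq : Set (BoundedContinuousFunction ℕ ℝ)) := by
  refine isClosed_of_closure_subset fun f hf => ?_
  obtain ⟨u, hu, hlim⟩ := mem_closure_iff_seq_limit.1 hf
  have hun := BoundedContinuousFunction.tendsto_iff_tendstoUniformly.1 hlim
  refine Metric.tendsto_atTop.2 fun ε hε => ?_
  obtain ⟨k, hk⟩ := (Metric.tendstoUniformly_iff.1 hun (ε / 2) (by positivity)).exists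
  obtain ⟨N, hN⟩ := Metric.tendsto_atTop.1 (hu k) (ε / 2) (by positivity)
  exact ⟨N, fun n hn => by linarith [dist_triangle (f n) (u k n) 0, hk n, hN n hn]⟩

instance SeqC.instBanachLattice : BanachLattice SeqC where
  toCompleteSpace := isClosed_convSeq.completeSpace_coe
  solid _ _ h := HasSolidNorm.solid (α := BoundedContinuousFunction ℕ ℝ) h
  add_le_add_left _ _ h k := add_le_add_left (α := BoundedContinuousFunction ℕ ℝ) h k.1
  smul_le_smul_of_nonneg_left _ hc _ _ h n := mul_le_mul_of_nonneg_left (h n) hc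
  smul_le_smul_of_nonneg_right _ hf _ _ h n := mul_le_mul_of_nonneg_right h (hf n)

instance SeqCZero.instBanachLattice : BanachLattice SeqCZero where
  toCompleteSpace := isClosed_nullSeq.completeSpace_coe
  solid _ _ h := HasSolidNorm.solid (α := BoundedContinuousFunction ℕ ℝ) h
  add_le_add_left _ _ h k := add_le_add_left (α := BoundedContinuousFunction ℕ ℝ) h k.1
  smul_le_smul_of_nonneg_left _ hc _ _ h n := mul_le_mul_of_nonneg_left (h n) hc
  smul_le_smul_of_nonneg_right _ hf _ _ h n := mul_le_mul_of_nonneg_right h (hf n)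

/-- The direct sum of two Banach lattices, with coordinatewise order and maximum norm. -/
instance instBanachLatticeProd (E F : Type*) [NormedAddCommGroup E] [NormedSpace ℝ E] [Lattice E]
    [BanachLattice E] [NormedAddCommGroup F] [NormedSpace ℝ F] [Lattice F] [BanachLattice F] :
    BanachLattice (E × F) where
  solid _ _ h := max_le_max (HasSolidNorm.solid h.1) (HasSolidNorm.solid h.2)
  smul_le_smul_of_nonneg_left _ hc _ _ h :=
    ⟨smul_le_smul_of_nonneg_left h.1 hc, smul_le_smul_of_nonneg_left h.2 hc⟩
  smul_le_smul_of_nonneg_right _ hf _ _ h :=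
    ⟨smul_le_smul_of_nonneg_right h hf.1, smul_le_smul_of_nonneg_right h hf.2⟩

end Spaces

end LimitedlyLwc

end

/-! The first two inclusions are soft. Bounded sets are dilates of subsets of the ball, and the
canonical embedding into the bidual, like every bounded operator, maps limited sets to limited sets,
so limited sets are bi-limited.

The inclusion in `BD` amounts to the fact that bounded Lwc-sets are relatively weakly compact
(`IsLwcSet.isRelativelyWeaklyCompact`). Such a set lies, up to `ε`, in an order interval `[-u, u]`
with `DisjointNull u` (`IsLwcSet.exists_disjointNull`). Monotone sequences in `[0, u]` are norm
Cauchy, whence a positive functional controls the norm there at a given scale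
(`DisjointNull.exists_control`). Composing it with the moduli `|x - t|`, for `t` on a grid of
multiples of `u`, gives a convex function whose convexity gaps bound distances
(`DisjointNull.hasConvexGaps`). Hence a family of closed convex subsets of `[0, u]`, stable under
finite intersections and without empty member, has a common point, and `[0, u]` is weakly compact.
Grothendieck's approximation criterion finishes.

The examples: in `ℓ²` orthonormal sequences are weakly null, hence uniformly null on bi-limited
sets, while the unit vectors are disjoint of norm one. In `c₀` distinct coordinate functionals are
weak-star null, but the unit vectors are bi-limited by Phillips' lemma in `ℓ^∞`. In `c` the
coordinates minus the limit are weak-star null, so limited sets are nearly finite dimensional, but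
the constant one dominates every unit vector. The projections onto the three summands of `E` then
separate the classes. -/

open Filter Topology

noncomputable section

namespace LimitedlyLwc

/-! ### Identities and disjointness in lattice ordered groups -/

section LatticeGroup

variable {E : Type*} [AddCommGroup E] [Lattice E] [IsOrderedAddMonoid E]

omit [IsOrderedAddMonoid E] in
theorem inf_eq_zero_of_le {a b c d : E} (ha : 0 ≤ a) (hb : 0 ≤ b) (hac : a ≤ c) (hbd : b ≤ d)
    (h : c ⊓ d = 0) : a ⊓ b = 0 :=
  le_antisymm (h ▸ inf_le_inf hac hbd) (le_inf ha hb)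

theorem sub_inf_inf_sub_inf (a b : E) : (a - a ⊓ b) ⊓ (b - a ⊓ b) = 0 := by
  rw [sub_eq_add_neg, sub_eq_add_neg, ← inf_add, add_neg_cancel]

theorem posPart_le_posPart_sub_add (a : E) {b : E} (hb : 0 ≤ b) : a⁺ ≤ (a - b)⁺ + b :=
  sup_le (sub_le_iff_le_add.1 (le_posPart _)) (add_nonneg (posPart_nonneg _) hb)

theorem posPart_sub_le_self {a b : E} (ha : 0 ≤ a) (hb : 0 ≤ b) : (a - b)⁺ ≤ a :=
  sup_le (sub_le_self a hb) ha

theorem sub_inf_eq_posPart (a b : E) : a - a ⊓ b = (a - b)⁺ := by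
  rw [posPart_def, sub_eq_add_neg, neg_inf, add_sup, add_neg_cancel, sup_comm, ← sub_eq_add_neg]

/-- Elements `z n` of which no `k` have a common positive lower bound. -/
def OverlapLT (k : ℕ) (z : ℕ → E) : Prop :=
  ∀ s : Finset ℕ, s.card = k → ∀ w, 0 ≤ w → (∀ i ∈ s, w ≤ z i) → w = 0

/-- By distributivity `b ↦ (b - c)⁺` preserves finite infima, so `D` is the infimum of the `d i`. -/
theorem exists_le_of_forall_le_posPart_sub {d : ℕ → E} {c w : E} (s : Finset ℕ)
    (hs : s.Nonempty) (h : ∀ i ∈ s, w ≤ (d i - c)⁺) :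
    ∃ D, (∀ i ∈ s, D ≤ d i) ∧ w ≤ (D - c)⁺ := by
  induction hs using Finset.Nonempty.cons_induction with
  | singleton a => exact ⟨d a, by simp, by simpa using h⟩
  | cons a s ha hs ih =>
    obtain ⟨D, hD, hw⟩ := ih fun i hi => h i (by simp [hi])
    refine ⟨d a ⊓ D, ?_, ?_⟩
    · simp only [Finset.mem_cons, forall_eq_or_imp]
      exact ⟨inf_le_left, fun i hi => inf_le_right.trans (hD i hi)⟩
    · have : (d a ⊓ D - c)⁺ = (d a - c)⁺ ⊓ (D - c)⁺ := by
        let := AddCommGroup.toDistribLattice E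
        simp only [posPart_def, sub_eq_add_neg, inf_add]
        exact sup_inf_right _ _ _
      rw [this]
      exact le_inf (h a (by simp)) hw

end LatticeGroup

/-! ### Cutting off and grid estimates in vector lattices -/

section VectorLattice

variable {E : Type*} [AddCommGroup E] [Module ℝ E] [Lattice E] [IsOrderedAddMonoid E]
  [IsOrderedModule ℝ E]

omit [IsOrderedAddMonoid E] in
theorem posPart_smul_le {r : ℝ} (hr : 0 ≤ r) (a : E) : (r • a)⁺ ≤ r • a⁺ :=
  sup_le (smul_le_smul_of_nonneg_left (le_posPart a) hr) (smul_nonneg hr (posPart_nonneg a))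

/-- The positive part of `a - r b` and that of `b - a / r` are disjoint, and so are the
smaller elements obtained from larger subtractions. -/
theorem posPart_sub_inf_posPart_sub {a b c d : E} {r : ℝ} (hr : 1 ≤ r) (hc : r⁻¹ • b ≤ c)
    (hd : r • a ≤ d) : (a - c)⁺ ⊓ (b - d)⁺ = 0 := by
  have hr0 : 0 < r := by linarith
  refine inf_eq_zero_of_le (posPart_nonneg _) (posPart_nonneg _) (c := (r • a - b)⁺)
    (d := (r • a - b)⁻) ?_ ?_ (posPart_inf_negPart_eq_zero _)
  · have h1 : a - c ≤ r⁻¹ • (r • a - b) := by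
      rw [smul_sub, inv_smul_smul₀ hr0.ne']
      exact sub_le_sub_left hc a
    refine (posPart_mono h1).trans ((posPart_smul_le (by positivity) _).trans ?_)
    simpa using smul_le_smul_of_nonneg_right (inv_le_one_of_one_le₀ hr)
      (posPart_nonneg (r • a - b))
  · rw [negPart_def, neg_sub, ← posPart_def]
    exact posPart_mono (sub_le_sub_left hd b)

/-- If `D` lies below `k` of the `d i`, then `k D ≤ u`, so `(D - u / k)⁺ = 0`. -/
theorem overlapLT_of_sum_le {d : ℕ → E} {u : E} (h : ∀ s : Finset ℕ, ∑ i ∈ s, d i ≤ u) {k : ℕ}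
    (hk : 0 < k) : OverlapLT k fun n => (d n - (k : ℝ)⁻¹ • u)⁺ := by
  intro s hs w hw hws
  obtain ⟨D, hD, hwD⟩ := exists_le_of_forall_le_posPart_sub s
    (Finset.card_pos.1 (hs ▸ hk)) hws
  have h1 : (k : ℝ) • D ≤ u := by
    rw [Nat.cast_smul_eq_nsmul, ← hs]
    exact (Finset.card_nsmul_le_sum s d D hD).trans (h s)
  have h2 : D ≤ (k : ℝ)⁻¹ • u := by
    have := smul_le_smul_of_nonneg_left h1 (inv_nonneg.2 (Nat.cast_nonneg (α := ℝ) k))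
    rwa [inv_smul_smul₀ (by positivity)] at this
  rw [posPart_eq_zero.2 (sub_nonpos.2 h2)] at hwD
  exact le_antisymm hwD hw

/-- The infimum of the distances from `m` to the first multiples of `e`. -/
def infGrid (m e : E) : ℕ → E
  | 0 => |m|
  | n + 1 => infGrid m e n ⊓ |m - ((n + 1 : ℕ) : ℝ) • e|

-- Up to the last grid point, `m` is within `e` of the grid. With `b = m - n e`, the induction step
-- rests on `(e + b) ⊓ (e - b) = e - |b| ≤ e`.
omit [IsOrderedModule ℝ E] in
theorem infGrid_le {m e : E} (hm : 0 ≤ m) (he : 0 ≤ e) (n : ℕ) :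
    infGrid m e n ≤ e + (m - (n : ℝ) • e)⁺ := by
  induction n with
  | zero => simp [infGrid, abs_of_nonneg hm, posPart_eq_self.2 hm, he]
  | succ n ih =>
    have hb : m - ((n + 1 : ℕ) : ℝ) • e = m - (n : ℝ) • e - e := by
      push_cast
      rw [add_smul, one_smul, sub_sub]
    rw [infGrid, hb]
    generalize m - (n : ℝ) • e = b at ih ⊢
    refine (inf_le_inf_right _ ih).trans ?_
    let := AddCommGroup.toDistribLattice E
    refine (show _ = _ from inf_sup_left _ _ _).le.trans ?_
    refine sup_le (inf_le_right.trans ?_) ?_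
    · exact (le_posPart _).trans (le_add_of_nonneg_left he)
    · refine le_trans ?_ (le_add_of_nonneg_right (posPart_nonneg _))
      rw [posPart_def, add_sup, add_zero]
      refine (show _ = _ from inf_sup_right _ _ _).le.trans ?_
      refine sup_le ?_ inf_le_left
      rw [neg_sub, sub_eq_add_neg, ← add_inf]
      refine add_le_of_nonpos_right ?_
      rw [← neg_neg b, neg_neg (-b), ← neg_sup, sup_comm]
      exact neg_nonpos.2 (abs_nonneg b)

omit [IsOrderedModule ℝ E] in
theorem abs_sub_le_convexity_gap (x y t : E) :
    |x - y| ≤ |x - t| + |y - t| - |x + y - (2 : ℝ) • t| + |x + y - (2 : ℝ) • t| := by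
  rw [sub_add_cancel, show x - y = (x - t) + -(y - t) by abel]
  exact (abs_add_le _ _).trans (by rw [abs_neg])

-- Each grid point bounds `|x - y|` by its own convexity gap plus its distance to `x + y`, up to a
-- factor 2 in scale. The gaps are nonnegative, so adding all of them leaves the infimum of those
-- distances as remainder.
omit [IsOrderedModule ℝ E] in
theorem abs_sub_le_infGrid (x y e : E) (n : ℕ) :
    |x - y| ≤ ∑ j ∈ Finset.range (n + 1),
      (|x - (j : ℝ) • e| + |y - (j : ℝ) • e| - |x + y - (2 : ℝ) • (j : ℝ) • e|) +
      infGrid (x + y) ((2 : ℝ) • e) n := by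
  have hpos : ∀ j : ℕ,
      0 ≤ |x - (j : ℝ) • e| + |y - (j : ℝ) • e| - |x + y - (2 : ℝ) • (j : ℝ) • e| := by
    intro j
    refine sub_nonneg.2 (le_trans (le_of_eq ?_) (abs_add_le _ _))
    congr 1
    rw [two_smul]
    abel
  induction n with
  | zero =>
    simpa [infGrid] using abs_sub_le_convexity_gap x y 0
  | succ n ih =>
    rw [infGrid, add_inf]
    refine le_inf (ih.trans ?_) ?_
    · rw [Finset.sum_range_succ _ (n + 1)]
      gcongr
      exact le_add_of_nonneg_right (hpos _)
    · rw [Finset.sum_range_succ, smul_comm]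
      refine (abs_sub_le_convexity_gap x y (((n + 1 : ℕ) : ℝ) • e)).trans ?_
      rw [smul_comm (2 : ℝ)]
      gcongr
      exact le_add_of_nonneg_left (Finset.sum_nonneg fun j _ => hpos j)

/-- For real numbers, the gap of `|· - t|` between `x` and `y` is nearly `|x - y|` when `t` is near
their midpoint, and a grid of mesh `u / n` has such a `t`. The doubled grid reaches `2u ≥ x + y`, so
only the mesh remains as error. -/
theorem abs_sub_le_sum_grid {x y u : E} (hx : 0 ≤ x) (hy : 0 ≤ y) (hxu : x ≤ u) (hyu : y ≤ u)
    {n : ℕ} (hn : 0 < n) :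
    |x - y| ≤ ∑ j ∈ Finset.range (n + 1), (|x - (j : ℝ) • (n : ℝ)⁻¹ • u| +
      |y - (j : ℝ) • (n : ℝ)⁻¹ • u| - |x + y - (2 : ℝ) • (j : ℝ) • (n : ℝ)⁻¹ • u|) +
      (2 : ℝ) • (n : ℝ)⁻¹ • u := by
  have hu := hx.trans hxu
  refine (abs_sub_le_infGrid x y ((n : ℝ)⁻¹ • u) n).trans ?_
  gcongr
  refine (infGrid_le (add_nonneg hx hy) (by positivity) n).trans ?_
  rw [smul_comm (n : ℝ), smul_inv_smul₀ (by positivity), posPart_eq_zero.2, add_zero]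
  rw [sub_nonpos, two_smul]
  exact add_le_add hxu hyu

end VectorLattice

/-! ### Order intervals in which disjoint sequences are null -/

section OrderInterval

variable {E : Type*} [NormedAddCommGroup E] [NormedSpace ℝ E] [Lattice E] [BanachLattice E]

theorem norm_le_norm_of_nonneg_of_le {a b : E} (ha : 0 ≤ a) (hab : a ≤ b) : ‖a‖ ≤ ‖b‖ :=
  norm_le_norm_of_abs_le_abs (by rwa [abs_of_nonneg ha, abs_of_nonneg (ha.trans hab)])

/-- Disjoint sequences in the order interval `[0, u]` are norm null. -/
def DisjointNull (u : E) : Prop :=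
  ∀ a : ℕ → E, (∀ n, 0 ≤ a n) → (∀ n, a n ≤ u) → (∀ m n, m ≠ n → a m ⊓ a n = 0) →
    Tendsto a atTop (𝓝 0)

omit [NormedSpace ℝ E] [BanachLattice E] in
theorem DisjointNull.zero : DisjointNull (0 : E) := fun a h0 h1 _ =>
  (funext fun n => le_antisymm (h1 n) (h0 n) : a = fun _ => 0) ▸ tendsto_const_nhds

/-- Riesz decomposition `a n = a n ⊓ u + (a n - u)⁺`: the second summand is at most `v`, and both
sequences remain disjoint. -/
theorem DisjointNull.add {u v : E} (hu0 : 0 ≤ u) (hv0 : 0 ≤ v) (hu : DisjointNull u)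
    (hv : DisjointNull v) : DisjointNull (u + v) := by
  intro a h0 h1 hd
  have h2 : ∀ n, 0 ≤ a n - a n ⊓ u := fun n => sub_nonneg.2 inf_le_left
  have h3 := hu (fun n => a n ⊓ u) (fun n => le_inf (h0 n) hu0) (fun n => inf_le_right)
    fun m n hmn => inf_eq_zero_of_le (le_inf (h0 m) hu0) (le_inf (h0 n) hu0) inf_le_left
      inf_le_left (hd m n hmn)
  have h4 := hv (fun n => a n - a n ⊓ u) h2
    (fun n => by
      rw [sub_inf_eq_posPart]
      exact sup_le (sub_le_iff_le_add'.2 (h1 n)) hv0)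
    fun m n hmn => inf_eq_zero_of_le (h2 m) (h2 n) (sub_le_self _ (le_inf (h0 m) hu0))
      (sub_le_self _ (le_inf (h0 n) hu0)) (hd m n hmn)
  simpa using h3.add h4

theorem DisjointNull.nsmul {u : E} (hu0 : 0 ≤ u) (hu : DisjointNull u) (n : ℕ) :
    DisjointNull (n • u) := by
  induction n with
  | zero => simpa using DisjointNull.zero
  | succ n ih =>
    rw [succ_nsmul]
    exact ih.add (nsmul_nonneg hu0 n) hu0 hu

theorem IsLwcSet.disjointNull_abs {A : Set E} (hA : IsLwcSet A) {x : E} (hx : x ∈ A) :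
    DisjointNull |x| := by
  intro a h0 h1 hd
  refine hA a (fun n => ⟨x, hx, ?_⟩) fun m n hmn => ?_
  · rw [abs_of_nonneg (h0 n)]
    exact h1 n
  · rw [abs_of_nonneg (h0 m), abs_of_nonneg (h0 n)]
    exact hd m n hmn

/-- Almost order boundedness of bounded L-weakly compact sets. -/
theorem IsLwcSet.exists_disjointNull {A : Set E} (hA : IsLwcSet A) (hb : Bornology.IsBounded A)
    {ε : ℝ} (hε : 0 < ε) :
    ∃ u : E, 0 ≤ u ∧ DisjointNull u ∧ ∀ x ∈ A, ‖(|x| - u)⁺‖ < ε := by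
  by_contra! H
  choose! g hgA hg using H
  -- `S n` is the sum of the `|x i|` with `i < n`, and `x n ∈ A` is the element for which the
  -- candidate `u = 4 ^ n S n` fails.
  let S : ℕ → E := fun n => Nat.rec 0 (fun n s => s + |g (4 ^ n • s)|) n
  let x : ℕ → E := fun n => g (4 ^ n • S n)
  have hS1 : ∀ n, S (n + 1) = S n + |x n| := fun n => rfl
  have hS : ∀ n, 0 ≤ S n ∧ DisjointNull (S n) := by
    intro n
    induction n with
    | zero => exact ⟨le_rfl, DisjointNull.zero⟩
    | succ n ih =>
      have hxA : x n ∈ A := hgA _ (nsmul_nonneg ih.1 _) (ih.2.nsmul ih.1 _)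
      rw [hS1]
      exact ⟨add_nonneg ih.1 (abs_nonneg _),
        ih.2.add ih.1 (abs_nonneg _) (hA.disjointNull_abs hxA)⟩
  have hxA : ∀ n, x n ∈ A := fun n =>
    hgA _ (nsmul_nonneg (hS n).1 _) ((hS n).2.nsmul (hS n).1 _)
  have hxε : ∀ n, ε ≤ ‖(|x n| - 4 ^ n • S n)⁺‖ := fun n =>
    hg _ (nsmul_nonneg (hS n).1 _) ((hS n).2.nsmul (hS n).1 _)
  have hxS : ∀ m n, m < n → |x m| ≤ S n := by
    intro m n hmn
    induction n, hmn using Nat.le_induction with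
    | base => exact hS1 m ▸ le_add_of_nonneg_left (hS m).1
    | succ n _ ih => exact ih.trans (hS1 n ▸ le_add_of_nonneg_right (abs_nonneg _))
  obtain ⟨C, hC⟩ := hb.exists_norm_le
  have hsum : Summable fun n => ((1 / 2 : ℝ) ^ n) • |x n| := by
    refine Summable.of_norm_bounded (g := fun n => (1 / 2 : ℝ) ^ n * C)
      (summable_geometric_two.mul_right C) fun n => ?_
    rw [norm_smul, norm_abs_eq_norm, Real.norm_of_nonneg (by positivity)]
    gcongr
    exact hC _ (hxA n)
  set v := ∑' n, ((1 / 2 : ℝ) ^ n) • |x n|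
  have hv : ∀ n, ((1 / 2 : ℝ) ^ n) • |x n| ≤ v := fun n =>
    hsum.le_tsum n fun i _ => smul_nonneg (by positivity) (abs_nonneg _)
  have hv0 : 0 ≤ v := tsum_nonneg fun i => smul_nonneg (by positivity) (abs_nonneg _)
  -- The first term of `c n` separates `x n` from its predecessors, the second from its successors;
  -- the second is small in norm, so cutting off `c n` still leaves almost `ε`.
  let c : ℕ → E := fun n => 4 ^ n • S n + ((1 / 2 : ℝ) ^ n) • v
  have hc0 : ∀ n, 0 ≤ c n := fun n =>
    add_nonneg (nsmul_nonneg (hS n).1 _) (smul_nonneg (by positivity) hv0)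
  have hdisj : ∀ m n, m < n → (|x m| - c m)⁺ ⊓ (|x n| - c n)⁺ = 0 := by
    intro m n hmn
    -- This ratio suits both cut-offs: `r ≤ 4 ^ n` since `m < n`, and `|x n| / r ≤ v / 2 ^ m`.
    refine posPart_sub_inf_posPart_sub (r := 2 ^ m * 2 ^ n)
      (by exact_mod_cast Nat.one_le_iff_ne_zero.2 (by positivity)) ?_ ?_
    · refine le_trans ?_ (le_add_of_nonneg_left (nsmul_nonneg (hS m).1 _))
      rw [show ((2 : ℝ) ^ m * 2 ^ n)⁻¹ = (1 / 2) ^ m * (1 / 2) ^ n by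
        rw [mul_inv, one_div, inv_pow, inv_pow], mul_smul]
      exact smul_le_smul_of_nonneg_left (hv n) (by positivity)
    · refine le_trans ?_ (le_add_of_nonneg_right (smul_nonneg (by positivity) hv0))
      rw [← Nat.cast_smul_eq_nsmul ℝ]
      refine (smul_le_smul_of_nonneg_left (hxS m n hmn) (by positivity)).trans
        (smul_le_smul_of_nonneg_right ?_ (hS n).1)
      push_cast
      rw [show (4 : ℝ) = 2 * 2 by norm_num, mul_pow]
      gcongr
      norm_num
  have hnull := hA (fun n => (|x n| - c n)⁺) (fun n => ⟨x n, hxA n, ?_⟩) fun m n hmn => ?_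
  rotate_left
  · rw [abs_of_nonneg (posPart_nonneg _)]
    exact posPart_sub_le_self (abs_nonneg _) (hc0 n)
  · rw [abs_of_nonneg (posPart_nonneg _), abs_of_nonneg (posPart_nonneg _)]
    rcases hmn.lt_or_gt with h | h
    · exact hdisj m n h
    · rw [inf_comm]
      exact hdisj n m h
  have hlow : ∀ n, ε ≤ ‖(|x n| - c n)⁺‖ + (1 / 2 : ℝ) ^ n * ‖v‖ := by
    intro n
    have h1 : (|x n| - 4 ^ n • S n)⁺ ≤ (|x n| - c n)⁺ + ((1 / 2 : ℝ) ^ n) • v := by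
      have := posPart_le_posPart_sub_add (|x n| - 4 ^ n • S n)
        (smul_nonneg (by positivity : (0 : ℝ) ≤ (1 / 2) ^ n) hv0)
      rwa [sub_sub] at this
    calc ε ≤ ‖(|x n| - 4 ^ n • S n)⁺‖ := hxε n
      _ ≤ ‖(|x n| - c n)⁺ + ((1 / 2 : ℝ) ^ n) • v‖ :=
        norm_le_norm_of_nonneg_of_le (posPart_nonneg _) h1
      _ ≤ ‖(|x n| - c n)⁺‖ + ‖((1 / 2 : ℝ) ^ n) • v‖ := norm_add_le _ _
      _ = _ := by rw [norm_smul, Real.norm_of_nonneg (by positivity)]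
  have hlim : Tendsto (fun n => ‖(|x n| - c n)⁺‖ + (1 / 2 : ℝ) ^ n * ‖v‖) atTop (𝓝 0) := by
    simpa using hnull.norm.add
      ((tendsto_pow_atTop_nhds_zero_of_lt_one (by norm_num : (0 : ℝ) ≤ 1 / 2)
        (by norm_num)).mul_const ‖v‖)
  exact absurd (ge_of_tendsto' hlim hlow) (not_le.2 hε)

/-- In an interval whose disjoint sequences are null, a sequence whose terms have null infima
with one another is null. -/
theorem DisjointNull.tendsto_of_inf {u : E} (hu : DisjointNull u) {z : ℕ → E}
    (hz0 : ∀ n, 0 ≤ z n) (hzu : ∀ n, z n ≤ u)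
    (h : ∀ m, Tendsto (fun n => z m ⊓ z n) atTop (𝓝 0)) : Tendsto z atTop (𝓝 0) := by
  by_contra H
  simp only [Metric.tendsto_atTop, dist_zero_right, not_forall, not_exists, not_lt] at H
  obtain ⟨ε, hε, H⟩ := H
  -- The second component is a strictly increasing label. It is at least the position in the
  -- sequence, which turns the pairwise bounds into geometric ones.
  obtain ⟨f, hf, hfr⟩ := exists_seq_of_forall_finset_exists
    (fun p : ℕ × ℕ => ε ≤ ‖z p.1‖)
    (fun p q => p.2 < q.2 ∧ ‖z p.1 ⊓ z q.1‖ ≤ ε / 16 * (1 / 4) ^ q.2) (by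
      intro s _
      set b := s.sup Prod.snd + 1
      have h1 : ∀ᶠ n in atTop, ∀ p ∈ s, ‖z p.1 ⊓ z n‖ ≤ ε / 16 * (1 / 4) ^ b := by
        rw [eventually_all_finset]
        intro p _
        have := (h p.1).norm
        rw [norm_zero] at this
        exact this.eventually_le_const (by positivity)
      obtain ⟨N, hN⟩ := eventually_atTop.1 h1
      obtain ⟨n, hn, hnε⟩ := by simpa using H N
      exact ⟨(n, b), hnε, fun p hp =>
        ⟨Nat.lt_succ_of_le (Finset.le_sup (f := Prod.snd) hp), hN n hn p hp⟩⟩)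
  let y : ℕ → E := fun n => z (f n).1
  have hlab : ∀ n, n ≤ (f n).2 := fun _ =>
    (strictMono_nat_of_lt_succ fun n => (hfr n (n + 1) n.lt_succ_self).1).le_apply
  have hsmall : ∀ m n, m < n → ‖y m ⊓ y n‖ ≤ ε / 16 * (1 / 4) ^ n := fun m n hmn =>
    (hfr m n hmn).2.trans (mul_le_mul_of_nonneg_left
      (pow_le_pow_of_le_one (by norm_num) (by norm_num) (hlab n)) (by positivity))
  -- The sum `v` of the `t n` dominates all infima `y m ⊓ y n` and has norm at most `ε / 8`;
  -- subtracting it makes the sequence disjoint at little cost.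
  let t : ℕ → E := fun n => ∑ i ∈ Finset.range n, y i ⊓ y n
  have hy0 : ∀ n, 0 ≤ y n := fun n => hz0 _
  have ht0 : ∀ n, 0 ≤ t n := fun n => Finset.sum_nonneg fun i _ => le_inf (hy0 _) (hy0 _)
  have hnpow : ∀ n : ℕ, (n : ℝ) * (1 / 4) ^ n ≤ (1 / 2) ^ n := by
    intro n
    have : (n : ℝ) ≤ 2 ^ n := by exact_mod_cast n.lt_two_pow_self.le
    calc (n : ℝ) * (1 / 4) ^ n ≤ 2 ^ n * (1 / 4) ^ n := by gcongr
      _ = (1 / 2) ^ n := by rw [← mul_pow]; norm_num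
  have htn : ∀ n, ‖t n‖ ≤ ε / 16 * (1 / 2) ^ n := by
    intro n
    refine (norm_sum_le_of_le _ fun i hi => hsmall i n (Finset.mem_range.1 hi)).trans ?_
    rw [Finset.sum_const, Finset.card_range, nsmul_eq_mul]
    have := mul_le_mul_of_nonneg_left (hnpow n) (by positivity : 0 ≤ ε / 16)
    linarith
  have hsum : Summable t :=
    Summable.of_norm_bounded (summable_geometric_two.mul_left (ε / 16)) htn
  have hvn : ‖∑' n, t n‖ ≤ ε / 16 * 2 :=
    tsum_of_norm_bounded (hasSum_geometric_two.mul_left (ε / 16)) htn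
  set v := ∑' n, t n
  have hv0 : 0 ≤ v := tsum_nonneg ht0
  have hv : ∀ m n, m < n → y m ⊓ y n ≤ v := fun m n hmn =>
    (Finset.single_le_sum (f := fun i => y i ⊓ y n) (fun i _ => le_inf (hy0 i) (hy0 n))
      (Finset.mem_range.2 hmn)).trans (hsum.le_tsum n fun i _ => ht0 i)
  have hd : ∀ m n, m < n → (y m - v)⁺ ⊓ (y n - v)⁺ = 0 := by
    intro m n hmn
    refine inf_eq_zero_of_le (posPart_nonneg _) (posPart_nonneg _)
      (sup_le (sub_le_sub_left (hv m n hmn) _) (sub_nonneg.2 inf_le_left))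
      (sup_le (sub_le_sub_left (hv m n hmn) _) (sub_nonneg.2 inf_le_right))
      (sub_inf_inf_sub_inf _ _)
  have hnull := hu (fun n => (y n - v)⁺) (fun n => posPart_nonneg _)
    (fun n => (posPart_sub_le_self (hy0 n) hv0).trans (hzu _)) fun m n hmn => by
      rcases hmn.lt_or_gt with h | h
      · exact hd m n h
      · rw [inf_comm]
        exact hd n m h
  have hlow : ∀ n, ε ≤ ‖(y n - v)⁺‖ + ‖v‖ := fun n =>
    (hf n).trans ((norm_le_norm_of_nonneg_of_le (hy0 n)
      ((le_posPart _).trans (posPart_le_posPart_sub_add _ hv0))).trans (norm_add_le _ _))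
  have := ge_of_tendsto' (hnull.norm.add_const ‖v‖) hlow
  rw [norm_zero] at this
  linarith

/-- Induction on `k`: for fixed `m`, the infima `z m ⊓ z n` with `n > m` have overlap one less than
`z`, because `m` counts as an additional index. -/
theorem DisjointNull.tendsto_of_overlapLT {u : E} (hu : DisjointNull u) {k : ℕ} (hk : 0 < k)
    {z : ℕ → E} (hz0 : ∀ n, 0 ≤ z n) (hzu : ∀ n, z n ≤ u) (h : OverlapLT k z) :
    Tendsto z atTop (𝓝 0) := by
  induction k, hk using Nat.le_induction generalizing z with
  | base =>
    have : z = fun _ => 0 := funext fun n => h {n} (by simp) (z n) (hz0 n) (by simp)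
    exact this ▸ tendsto_const_nhds
  | succ k hk ih =>
    refine hu.tendsto_of_inf hz0 hzu fun m => ?_
    rw [← tendsto_add_atTop_iff_nat (m + 1)]
    refine ih (fun n => le_inf (hz0 _) (hz0 _)) (fun n => inf_le_left.trans (hzu _)) ?_
    intro s hs w hw hws
    refine h (insert m (s.map (addRightEmbedding (m + 1)))) ?_ w hw ?_
    · rw [Finset.card_insert_of_notMem, Finset.card_map, hs]
      simp only [Finset.mem_map, addRightEmbedding_apply, not_exists, not_and]
      intro a _
      lia
    · obtain ⟨i, hi⟩ := Finset.card_pos.1 (hs ▸ hk : 0 < s.card)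
      simp only [Finset.mem_insert, Finset.mem_map, addRightEmbedding_apply,
        forall_eq_or_imp, forall_exists_index, and_imp]
      refine ⟨(hws i hi).trans inf_le_left, ?_⟩
      rintro _ a ha rfl
      exact (hws a ha).trans inf_le_right

/-- Otherwise there are increments of norm at least `ε` whose finite sums stay below `u`. Cutting
them off at `u / k` leaves bounded overlap, hence a null sequence, while `u / k` has norm below `ε /
2`. -/
theorem DisjointNull.cauchySeq {u : E} (hu : DisjointNull u) {x : ℕ → E} (hx : Monotone x)
    (hx0 : ∀ n, 0 ≤ x n) (hxu : ∀ n, x n ≤ u) : CauchySeq x := by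
  by_contra H
  have hu0 := (hx0 0).trans (hxu 0)
  simp only [Metric.cauchySeq_iff', not_forall, not_exists, not_lt] at H
  obtain ⟨ε, hε, H⟩ := H
  choose g hg hgε using H
  simp only [ge_iff_le] at hg hgε
  let φ : ℕ → ℕ := fun n => g^[n] 0
  have hφ : ∀ n, φ (n + 1) = g (φ n) := fun n => Function.iterate_succ_apply' g n 0
  have hφm : Monotone φ := monotone_nat_of_le_succ fun n => by
    rw [hφ]
    exact hg _
  let d : ℕ → E := fun n => x (φ (n + 1)) - x (φ n)
  have hd0 : ∀ n, 0 ≤ d n := fun n => sub_nonneg.2 (hx (hφm n.le_succ))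
  have hdε : ∀ n, ε ≤ ‖d n‖ := fun n => by
    have := hgε (φ n)
    rwa [dist_eq_norm, ← hφ] at this
  have hds : ∀ s : Finset ℕ, ∑ i ∈ s, d i ≤ u := by
    intro s
    obtain ⟨N, hN⟩ := s.exists_nat_subset_range
    refine (Finset.sum_le_sum_of_subset_of_nonneg hN fun i _ _ => hd0 i).trans ?_
    rw [Finset.sum_range_sub (fun n => x (φ n))]
    exact (sub_le_self _ (hx0 _)).trans (hxu _)
  obtain ⟨k, hk⟩ := exists_nat_gt (‖u‖ / (ε / 2))
  have hk0 : (0 : ℝ) < k := lt_of_le_of_lt (by positivity) hk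
  have hc0 : 0 ≤ (k : ℝ)⁻¹ • u := smul_nonneg (by positivity) hu0
  have hnull := hu.tendsto_of_overlapLT (Nat.cast_pos.1 hk0)
    (z := fun n => (d n - (k : ℝ)⁻¹ • u)⁺) (fun n => posPart_nonneg _)
    (fun n => (posPart_sub_le_self (hd0 n) hc0).trans (by simpa using hds {n}))
    (overlapLT_of_sum_le hds (Nat.cast_pos.1 hk0))
  have hlow : ∀ n, ε ≤ ‖(d n - (k : ℝ)⁻¹ • u)⁺‖ + ‖(k : ℝ)⁻¹ • u‖ := fun n =>
    (hdε n).trans ((norm_le_norm_of_nonneg_of_le (hd0 n)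
      ((le_posPart _).trans (posPart_le_posPart_sub_add _ hc0))).trans (norm_add_le _ _))
  have h1 := ge_of_tendsto' (hnull.norm.add_const ‖(k : ℝ)⁻¹ • u‖) hlow
  rw [norm_zero, zero_add, norm_smul, norm_inv, RCLike.norm_natCast, inv_mul_eq_div] at h1
  have h2 : ‖u‖ / k < ε / 2 := by
    rw [div_lt_iff₀ hk0]
    rw [div_lt_iff₀ (by positivity)] at hk
    linarith
  linarith

end OrderInterval

/-! ### Control of the norm by positive functionals -/

section Control

variable {E : Type*} [NormedAddCommGroup E] [NormedSpace ℝ E] [Lattice E] [BanachLattice E]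

theorem posPart_real_smul {r : ℝ} (hr : 0 < r) (a : E) : (r • a)⁺ = r • a⁺ := by
  refine le_antisymm (posPart_smul_le hr.le a) ?_
  have := smul_le_smul_of_nonneg_left (posPart_smul_le (inv_nonneg.2 hr.le) (r • a)) hr.le
  rwa [inv_smul_smul₀ hr.ne', smul_inv_smul₀ hr.ne'] at this

theorem posPart_add_le (a b : E) : (a + b)⁺ ≤ a⁺ + b⁺ :=
  sup_le (add_le_add (le_posPart a) (le_posPart b))
    (add_nonneg (posPart_nonneg a) (posPart_nonneg b))

theorem norm_posPart_le (a : E) : ‖a⁺‖ ≤ ‖a‖ :=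
  norm_le_norm_of_abs_le_abs (by
    rw [abs_of_nonneg (posPart_nonneg a)]
    exact sup_le (le_abs_self a) (abs_nonneg a))

/-- Positive elements are normed by positive functionals. -/
theorem exists_positive_norming (x : E) (hx : 0 ≤ x) :
    ∃ f : StrongDual ℝ E, (∀ y, 0 ≤ y → 0 ≤ f y) ∧ (∀ y, f y ≤ ‖y‖) ∧ f x = ‖x‖ := by
  by_cases hx0 : x = 0
  · exact ⟨0, by simp, by simp, by simp [hx0]⟩
  let f₀ : E →ₗ.[ℝ] ℝ := LinearPMap.mkSpanSingleton x ‖x‖ hx0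
  -- Domination by `‖y⁺‖` instead of `‖y‖` forces positivity: `g (-y) ≤ 0` for `y ≥ 0`.
  obtain ⟨g, hg, hgle⟩ := exists_extension_of_le_sublinear f₀ (fun y => ‖y⁺‖)
    (fun c hc y => by
      rw [posPart_real_smul hc, norm_smul, Real.norm_of_nonneg hc.le])
    (fun y z => (norm_le_norm_of_nonneg_of_le (posPart_nonneg _) (posPart_add_le y z)).trans
      (norm_add_le _ _))
    (by
      rintro ⟨y, hy⟩
      obtain ⟨c, rfl⟩ := Submodule.mem_span_singleton.1 hy
      rw [show f₀ ⟨c • x, hy⟩ = c * ‖x‖ from LinearPMap.mkSpanSingleton'_apply _ _ _ _ _]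
      rcases le_or_gt c 0 with hc | hc
      · exact (mul_nonpos_of_nonpos_of_nonneg hc (norm_nonneg _)).trans (norm_nonneg _)
      · simp only [posPart_real_smul hc, norm_smul, Real.norm_of_nonneg hc.le,
          posPart_eq_self.2 hx, le_refl])
  have hle : ∀ y, g y ≤ ‖y‖ := fun y => (hgle y).trans (norm_posPart_le y)
  refine ⟨g.mkContinuous 1 fun y => ?_, fun y hy => ?_, hle, ?_⟩
  · rw [one_mul, Real.norm_eq_abs, abs_le]
    have := hle (-y)
    rw [map_neg, norm_neg] at this
    exact ⟨by linarith, hle y⟩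
  · have := hgle (-y)
    rw [posPart_eq_zero.2 (neg_nonpos.2 hy), map_neg, norm_zero] at this
    simpa using this
  · have := hg ⟨x, Submodule.mem_span_singleton_self x⟩
    exact this.trans (LinearPMap.mkSpanSingleton_apply ℝ ℝ hx0 ‖x‖)

theorem le_of_nonneg_functional {f : StrongDual ℝ E} (hf : ∀ y, 0 ≤ y → 0 ≤ f y) {x y : E}
    (h : x ≤ y) : f x ≤ f y := by
  have := hf _ (sub_nonneg.2 h)
  rwa [map_sub, sub_nonneg] at this

/-- On an interval whose disjoint sequences are null, the norm is controlled by positive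
functionals. -/
theorem DisjointNull.exists_control {u : E} (hu : DisjointNull u) {ε : ℝ}
    (hε : 0 < ε) :
    ∃ f : StrongDual ℝ E, (∀ y, 0 ≤ y → 0 ≤ f y) ∧ ∃ δ > 0, ∀ x, 0 ≤ x → x ≤ u → f x < δ →
      ‖x‖ < ε := by
  by_contra! H
  -- Each new element is nearly annihilated by the sum of the norming functionals chosen before. The
  -- last component is again a label bounding the position.
  obtain ⟨p, hp, hpr⟩ := exists_seq_of_forall_finset_exists
    (fun p : E × StrongDual ℝ E × ℕ => 0 ≤ p.1 ∧ p.1 ≤ u ∧ (∀ y, 0 ≤ y → 0 ≤ p.2.1 y) ∧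
      (∀ y, p.2.1 y ≤ ‖y‖) ∧ ε ≤ p.2.1 p.1)
    (fun p q => p.2.2 < q.2.2 ∧ p.2.1 q.1 ≤ (1 / 2) ^ q.2.2) (by
      intro s hs
      have hpos : ∀ y, 0 ≤ y → 0 ≤ (∑ p ∈ s, p.2.1) y := fun y hy => by
        rw [_root_.sum_apply]
        exact Finset.sum_nonneg fun p hp => (hs p hp).2.2.1 y hy
      set b := s.sup (fun p => p.2.2) + 1
      obtain ⟨x, hx0, hxu, hxs, hxε⟩ := H _ hpos ((1 / 2) ^ b) (by positivity)
      obtain ⟨g, hg0, hg1, hgx⟩ := exists_positive_norming x hx0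
      refine ⟨(x, g, b), ⟨hx0, hxu, hg0, hg1, hgx ▸ hxε⟩, fun p hp => ⟨?_, ?_⟩⟩
      · exact Nat.lt_succ_of_le (Finset.le_sup (f := fun p => p.2.2) hp)
      · rw [_root_.sum_apply] at hxs
        exact (Finset.single_le_sum (f := fun p => p.2.1 x)
          (fun q hq => (hs q hq).2.2.1 x hx0) hp).trans hxs.le)
  let x : ℕ → E := fun n => (p n).1
  let f : ℕ → StrongDual ℝ E := fun n => (p n).2.1
  have hx0 : ∀ n, 0 ≤ x n := fun n => (hp n).1
  have hxu : ∀ n, x n ≤ u := fun n => (hp n).2.1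
  have hf0 : ∀ n y, 0 ≤ y → 0 ≤ f n y := fun n => (hp n).2.2.1
  have hf1 : ∀ n y, f n y ≤ ‖y‖ := fun n => (hp n).2.2.2.1
  have hfx : ∀ n, ε ≤ f n (x n) := fun n => (hp n).2.2.2.2
  have hlab : ∀ n, n ≤ (p n).2.2 := fun _ =>
    (strictMono_nat_of_lt_succ fun n => (hpr n (n + 1) n.lt_succ_self).1).le_apply
  have hfs : ∀ m n, m < n → f m (x n) ≤ (1 / 2) ^ n := fun m n hmn =>
    (hpr m n hmn).2.trans (pow_le_pow_of_le_one (by norm_num) (by norm_num) (hlab n))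
  -- The norm limit `s n` of `w n` acts as the supremum of the `x i` with `i ≥ n`.
  let w : ℕ → ℕ → E := fun n k => partialSups (fun i => x (n + i)) k
  have hw0 : ∀ n k, 0 ≤ w n k := fun n k =>
    (hx0 _).trans (le_partialSups_of_le (fun i => x (n + i)) (Nat.zero_le k))
  have hwu : ∀ n k, w n k ≤ u := fun n k => partialSups_le _ _ _ fun i _ => hxu _
  have hwm : ∀ n, Monotone (w n) := fun n => (partialSups fun i => x (n + i)).monotone
  have hlim : ∀ n, ∃ s, Tendsto (w n) atTop (𝓝 s) := fun n =>
    cauchySeq_tendsto_of_complete (hu.cauchySeq (hwm n) (hw0 n) (hwu n))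
  choose s hs using hlim
  have hws : ∀ n k, w n k ≤ s n := fun n => (hwm n).ge_of_tendsto (hs n)
  have hxs : ∀ n, x n ≤ s n := fun n => by
    have := hws n 0
    simpa [w] using this
  have hs0 : ∀ n, 0 ≤ s n := fun n => (hx0 n).trans (hxs n)
  have hsu : ∀ n, s n ≤ u := fun n => le_of_tendsto' (hs n) (hwu n)
  have hanti : ∀ n, s (n + 1) ≤ s n := fun n => by
    refine le_of_tendsto' (hs (n + 1)) fun k => partialSups_le _ _ _ fun i hi => ?_
    refine le_trans ?_ (hws n (i + 1))
    have := le_partialSups (fun i => x (n + i)) (i + 1)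
    rwa [show n + 1 + i = n + (i + 1) by ring]
  have hfsum : ∀ n, f n (s (n + 1)) ≤ (1 / 2) ^ n := by
    intro n
    refine le_of_tendsto' ((f n).continuous.tendsto _ |>.comp (hs (n + 1))) fun k => ?_
    have h1 : w (n + 1) k ≤ ∑ i ∈ Finset.range (k + 1), x (n + 1 + i) :=
      partialSups_le _ _ _ fun i hi => Finset.single_le_sum (f := fun i => x (n + 1 + i))
        (fun j _ => hx0 _) (Finset.mem_range.2 (Nat.lt_succ_of_le hi))
    refine (le_of_nonneg_functional (hf0 n) h1).trans ?_
    rw [map_sum]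
    refine (Finset.sum_le_sum fun i _ => hfs n (n + 1 + i) (by lia)).trans ?_
    have h2 : ∀ i : ℕ, (1 / 2 : ℝ) ^ (n + 1 + i) = (1 / 2) ^ n * (1 / 2) * (1 / 2) ^ i := by
      intro i
      rw [pow_add, pow_succ]
    simp only [h2, ← Finset.mul_sum]
    have h3 := Summable.sum_le_tsum (Finset.range (k + 1)) (fun i _ => by positivity)
      summable_geometric_two
    rw [tsum_geometric_two] at h3
    have h4 : (0 : ℝ) < (1 / 2) ^ n := by positivity
    nlinarith
  have hcauchy : CauchySeq fun n => u - s n :=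
    hu.cauchySeq (monotone_nat_of_le_succ fun n => sub_le_sub_left (hanti n) u)
      (fun n => sub_nonneg.2 (hsu n)) fun n => sub_le_self _ (hs0 n)
  obtain ⟨r, hr⟩ := cauchySeq_tendsto_of_complete hcauchy
  have hdiff : Tendsto (fun n => ‖s n - s (n + 1)‖) atTop (𝓝 0) := by
    have := ((hr.comp (tendsto_add_atTop_nat 1)).sub hr).norm
    simpa using this
  -- `f n` is at least `ε` on `s n` but at most `2⁻ⁿ` on `s (n + 1)`, whereas the decreasing
  -- sequence `s` converges in norm.
  have hbound : ∀ n, ε ≤ ‖s n - s (n + 1)‖ + (1 / 2) ^ n := by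
    intro n
    have h1 := le_of_nonneg_functional (hf0 n) (hxs n)
    have h2 := hf1 n (s n - s (n + 1))
    rw [map_sub] at h2
    linarith [hfx n, hfsum n]
  have := ge_of_tendsto' (hdiff.add (tendsto_pow_atTop_nhds_zero_of_lt_one
    (by norm_num : (0 : ℝ) ≤ 1 / 2) (by norm_num))) hbound
  linarith

end Control

/-! ### Weak compactness through convex filter bases -/

section WeakCompactness

open scoped Pointwise

variable {X : Type*} [NormedAddCommGroup X] [NormedSpace ℝ X]

theorem tendsto_toWeakSpace {α : Type*} {l : Filter α} {g : α → X} {x : X}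
    (h : ∀ f : StrongDual ℝ X, Tendsto (fun a => f (g a)) l (𝓝 (f x))) :
    Tendsto (fun a => toWeakSpace ℝ X (g a)) l (𝓝 (toWeakSpace ℝ X x)) := by
  have hind : Topology.IsInducing (fun (y : WeakSpace ℝ X) (f : StrongDual ℝ X) =>
    f ((toWeakSpace ℝ X).symm y)) := ⟨rfl⟩
  exact hind.tendsto_nhds_iff.2 (tendsto_pi_nhds.2 h)

theorem continuous_weakSpace_apply (f : StrongDual ℝ X) :
    Continuous fun y : WeakSpace ℝ X => f ((toWeakSpace ℝ X).symm y) :=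
  WeakBilin.eval_continuous _ f

theorem isClosed_image_toWeakSpace {K : Set X} (hc : IsClosed K) (hK : Convex ℝ K) :
    IsClosed (toWeakSpace ℝ X '' K) := by
  have := hK.toWeakSpace_closure ℝ
  rw [hc.closure_eq] at this
  rw [this]
  exact isClosed_closure

/-- A family of nonempty closed convex sets that is stable under intersections. -/
structure IsConvexFilterBase (𝒞 : Set (Set X)) : Prop where
  isClosed : ∀ K ∈ 𝒞, IsClosed K
  convex : ∀ K ∈ 𝒞, Convex ℝ K
  nonempty : ∀ K ∈ 𝒞, K.Nonempty
  inter : ∀ K ∈ 𝒞, ∀ L ∈ 𝒞, K ∩ L ∈ 𝒞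

theorem IsConvexFilterBase.exists_maximal {𝒞₀ : Set (Set X)} (h : IsConvexFilterBase 𝒞₀) :
    ∃ 𝒞, 𝒞₀ ⊆ 𝒞 ∧ Maximal IsConvexFilterBase 𝒞 := by
  refine zorn_subset_nonempty {𝒞 | IsConvexFilterBase 𝒞} (fun c hc hchain _ => ?_) 𝒞₀ h
  refine ⟨⋃₀ c, ⟨?_, ?_, ?_, ?_⟩, fun s hs => Set.subset_sUnion_of_mem hs⟩
  · rintro K ⟨s, hs, hK⟩
    exact (hc hs).isClosed K hK
  · rintro K ⟨s, hs, hK⟩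
    exact (hc hs).convex K hK
  · rintro K ⟨s, hs, hK⟩
    exact (hc hs).nonempty K hK
  · rintro K ⟨s, hs, hK⟩ L ⟨t, ht, hL⟩
    rcases hchain.total hs ht with hst | hst
    · exact ⟨t, ht, (hc ht).inter K (hst hK) L hL⟩
    · exact ⟨s, hs, (hc hs).inter K hK L (hst hL)⟩

/-- A bounded continuous convex function is almost constant on some member of a maximal
filter base of convex sets. -/
theorem exists_mem_forall_mem_Icc {𝒞 : Set (Set X)} (h𝒞 : Maximal IsConvexFilterBase 𝒞)
    {K₀ : Set X} (hK₀ : K₀ ∈ 𝒞) {Φ : X → ℝ} (hΦc : Continuous Φ)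
    (hΦ : ConvexOn ℝ Set.univ Φ) (hΦ0 : ∀ x, 0 ≤ Φ x) {M : ℝ} (hM : ∀ x ∈ K₀, Φ x ≤ M)
    {δ : ℝ} (hδ : 0 < δ) :
    ∃ l, ∃ K ∈ 𝒞, ∀ x ∈ K, Φ x ∈ Set.Icc (l - δ) (l + δ) := by
  have hb := h𝒞.prop
  -- By maximality a sublevel set with level in `S` can be intersected with members of `𝒞`; a level
  -- below `inf S` is missed by some member. Both together squeeze `Φ` around `l = inf S`.
  let S : Set ℝ := {r | ∀ K ∈ 𝒞, (K ∩ {x | Φ x ≤ r}).Nonempty}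
  have hMS : M ∈ S := fun K hK => by
    obtain ⟨x, hx, hx0⟩ := hb.nonempty _ (hb.inter K hK K₀ hK₀)
    exact ⟨x, hx, hM x hx0⟩
  have hSb : BddBelow S := ⟨0, fun r hr => by
    obtain ⟨x, -, hx⟩ := hr K₀ hK₀
    exact (hΦ0 x).trans hx⟩
  obtain ⟨r, hrS, hr⟩ := exists_lt_of_csInf_lt ⟨M, hMS⟩
    (lt_add_of_pos_right (sInf S) hδ)
  have hnot : sInf S - δ ∉ S := fun h => by linarith [csInf_le hSb h]
  simp only [S, Set.mem_ofPred_eq, not_forall, Set.not_nonempty_iff_eq_empty] at hnot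
  obtain ⟨K₁, hK₁, hemp⟩ := hnot
  have hlevc : IsClosed {x | Φ x ≤ r} := isClosed_le hΦc continuous_const
  have hlevx : Convex ℝ {x | Φ x ≤ r} := by simpa using hΦ.convex_le r
  have hbase : IsConvexFilterBase (𝒞 ∪ (fun K => K ∩ {x | Φ x ≤ r}) '' 𝒞) := by
    refine ⟨?_, ?_, ?_, ?_⟩
    · rintro K (hK | ⟨K, hK, rfl⟩)
      exacts [hb.isClosed K hK, (hb.isClosed K hK).inter hlevc]
    · rintro K (hK | ⟨K, hK, rfl⟩)
      exacts [hb.convex K hK, (hb.convex K hK).inter hlevx]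
    · rintro K (hK | ⟨K, hK, rfl⟩)
      exacts [hb.nonempty K hK, hrS K hK]
    · rintro K (hK | ⟨K, hK, rfl⟩) L (hL | ⟨L, hL, rfl⟩)
      · exact Or.inl (hb.inter K hK L hL)
      · exact Or.inr ⟨K ∩ L, hb.inter K hK L hL, by simp only [Set.inter_assoc]⟩
      · exact Or.inr ⟨K ∩ L, hb.inter K hK L hL, by simp only [Set.inter_right_comm]⟩
      · exact Or.inr ⟨K ∩ L, hb.inter K hK L hL, Set.inter_inter_distrib_right _ _ _⟩
  have hlev : K₁ ∩ {x | Φ x ≤ r} ∈ 𝒞 :=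
    h𝒞.le_of_ge hbase Set.subset_union_left (Or.inr ⟨K₁, hK₁, rfl⟩)
  refine ⟨sInf S, _, hlev, fun x hx => ⟨?_, hx.2.trans hr.le⟩⟩
  by_contra hlt
  exact Set.notMem_empty x (hemp ▸ ⟨hx.1, (not_le.1 hlt).le⟩)

/-- A uniform convexity property of a set: distances are controlled by the convexity gaps of
bounded continuous convex functions. -/
def HasConvexGaps (C : Set X) : Prop :=
  ∀ ε > 0, ∃ Φ : X → ℝ, Continuous Φ ∧ ConvexOn ℝ Set.univ Φ ∧ (∀ x, 0 ≤ Φ x) ∧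
    (∃ M, ∀ x ∈ C, Φ x ≤ M) ∧ ∃ η > 0, ∀ x ∈ C, ∀ y ∈ C,
      Φ x + Φ y - 2 * Φ (midpoint ℝ x y) ≤ η → dist x y ≤ ε

/-- On a convex set where `Φ` varies by at most `η / 4` around `l`, convexity gaps are at most `η`.
A maximal filter base thus has members of arbitrarily small diameter, and completeness provides the
common point. -/
theorem HasConvexGaps.exists_mem [CompleteSpace X] {C : Set X} (hC : HasConvexGaps C)
    {𝒞₀ : Set (Set X)} (h : IsConvexFilterBase 𝒞₀) (hC₀ : C ∈ 𝒞₀) :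
    ∃ x, ∀ K ∈ 𝒞₀, x ∈ K := by
  obtain ⟨𝒞, h𝒞, hmax⟩ := h.exists_maximal
  have hb := hmax.prop
  have hsmall : ∀ ε > 0, ∃ K ∈ 𝒞, ∀ x ∈ K, ∀ y ∈ K, dist x y ≤ ε := by
    intro ε hε
    obtain ⟨Φ, hc, hconv, h0, ⟨M, hM⟩, η, hη, hgap⟩ := hC ε hε
    obtain ⟨l, K, hK, hl⟩ := exists_mem_forall_mem_Icc hmax (h𝒞 hC₀) hc hconv h0 hM
      (by positivity : 0 < η / 4)
    refine ⟨K ∩ C, hb.inter K hK C (h𝒞 hC₀), fun x hx y hy => hgap x hx.2 y hy.2 ?_⟩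
    have h1 := (hl x hx.1).2
    have h2 := (hl y hy.1).2
    have h3 := (hl _ ((hb.convex K hK).midpoint_mem hx.1 hy.1)).1
    linarith
  choose! L hL hLd using hsmall
  have hpos : ∀ n : ℕ, (0 : ℝ) < 1 / (n + 1) := fun n => Nat.one_div_pos_of_nat
  choose x hx using fun n : ℕ => hb.nonempty _ (hL (1 / (n + 1)) (hpos n))
  have hdist : ∀ m n : ℕ, dist (x m) (x n) ≤ 1 / (m + 1) + 1 / (n + 1) := by
    intro m n
    obtain ⟨z, hzm, hzn⟩ := hb.nonempty _ (hb.inter _ (hL _ (hpos m)) _ (hL _ (hpos n)))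
    exact (dist_triangle _ z _).trans (add_le_add (hLd _ (hpos m) _ (hx m) _ hzm)
      (hLd _ (hpos n) _ hzn _ (hx n)))
  have hlim0 := tendsto_one_div_add_atTop_nhds_zero_nat (𝕜 := ℝ)
  have hcauchy : CauchySeq x := by
    refine cauchySeq_of_le_tendsto_0 (fun n : ℕ => 1 / ((n : ℝ) + 1) + 1 / (n + 1))
      (fun m n N hm hn => (hdist m n).trans ?_) (by simpa using hlim0.add hlim0)
    gcongr
  obtain ⟨a, ha⟩ := cauchySeq_tendsto_of_complete hcauchy
  refine ⟨a, fun K hK => ?_⟩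
  choose y hy using fun n : ℕ => hb.nonempty _ (hb.inter _ (hL _ (hpos n)) K (h𝒞 hK))
  refine (h.isClosed K hK).mem_of_tendsto (b := atTop) (f := y) ?_
    (Eventually.of_forall fun n => (hy n).2)
  refine (tendsto_iff_of_dist ?_).1 ha
  exact squeeze_zero (fun n => dist_nonneg)
    (fun n => hLd _ (hpos n) _ (hx n) _ (hy n).1) hlim0

/-- The closed convex members of an ultrafilter containing `C` have a common point. It is the weak
limit, since closed half-spaces are among the sets tested. -/
theorem HasConvexGaps.isCompact_toWeakSpace [CompleteSpace X] {C : Set X}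
    (hC : HasConvexGaps C) (hcl : IsClosed C) (hcv : Convex ℝ C) :
    IsCompact (toWeakSpace ℝ X '' C) := by
  refine isCompact_iff_ultrafilter_le_nhds'.2 fun U hU => ?_
  let V : Ultrafilter X := U.map (toWeakSpace ℝ X).symm
  have hCV : C ∈ V := by
    rw [Ultrafilter.mem_map]
    convert hU using 1
    exact ((toWeakSpace ℝ X).toEquiv.image_eq_preimage_symm C).symm
  have hbase : IsConvexFilterBase {K : Set X | IsClosed K ∧ Convex ℝ K ∧ K ∈ V} :=
    ⟨fun K hK => hK.1, fun K hK => hK.2.1, fun K hK => V.nonempty_of_mem hK.2.2,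
      fun K hK L hL => ⟨hK.1.inter hL.1, hK.2.1.inter hL.2.1, inter_mem hK.2.2 hL.2.2⟩⟩
  obtain ⟨x, hx⟩ := hC.exists_mem hbase ⟨hcl, hcv, hCV⟩
  refine ⟨toWeakSpace ℝ X x, ⟨x, hx C ⟨hcl, hcv, hCV⟩, rfl⟩, ?_⟩
  have hlim : ∀ f : StrongDual ℝ X, Tendsto f V (𝓝 (f x)) := by
    intro f
    rw [tendsto_order]
    constructor
    · intro a ha
      by_contra hn
      have h1 : {y | f y ≤ a} ∈ V := by
        have := Ultrafilter.eventually_not.2 hn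
        filter_upwards [this] with y hy using not_lt.1 hy
      exact absurd (hx {y | f y ≤ a} ⟨isClosed_le f.continuous continuous_const,
        convex_halfSpace_le f.toLinearMap.isLinear a, h1⟩) (not_le.2 ha)
    · intro a ha
      by_contra hn
      have h1 : {y | a ≤ f y} ∈ V := by
        have := Ultrafilter.eventually_not.2 hn
        filter_upwards [this] with y hy using not_lt.1 hy
      exact absurd (hx {y | a ≤ f y} ⟨isClosed_le continuous_const f.continuous,
        convex_halfSpace_ge f.toLinearMap.isLinear a, h1⟩) (not_le.2 ha)
  have := tendsto_toWeakSpace (X := X) (l := V) (g := fun y => y) hlim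
  have h2 : Tendsto (fun y => toWeakSpace ℝ X ((toWeakSpace ℝ X).symm y)) U
    (𝓝 (toWeakSpace ℝ X x)) := this.comp tendsto_map
  simpa [Tendsto] using h2

/-- Grothendieck's criterion: a set that is uniformly close to weakly compact sets is
relatively weakly compact. -/
theorem isRelativelyWeaklyCompact_of_forall_near [CompleteSpace X] {A : Set X}
    (h : ∀ ε > 0, ∃ W : Set X, IsCompact (toWeakSpace ℝ X '' W) ∧
      ∀ x ∈ A, ∃ w ∈ W, ‖x - w‖ ≤ ε) : IsRelativelyWeaklyCompact A := by
  have hball : ∀ r : ℝ, IsClosed (toWeakSpace ℝ X '' Metric.closedBall 0 r) := fun r =>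
    isClosed_image_toWeakSpace Metric.isClosed_closedBall (convex_closedBall 0 r)
  have h' : ∀ n : ℕ, ∃ W : Set X, IsCompact (toWeakSpace ℝ X '' W) ∧
      ∀ x, toWeakSpace ℝ X x ∈ closure (toWeakSpace ℝ X '' A) →
        ∃ w ∈ W, ‖x - w‖ ≤ 1 / (n + 1) := by
    intro n
    obtain ⟨W, hW, hAW⟩ := h (1 / (n + 1)) Nat.one_div_pos_of_nat
    refine ⟨W, hW, fun x hx => ?_⟩
    have hcl := (hball (1 / (n + 1))).add_left_of_isCompact hW
    have hsub : toWeakSpace ℝ X '' A ⊆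
        toWeakSpace ℝ X '' W + toWeakSpace ℝ X '' Metric.closedBall 0 (1 / (n + 1)) := by
      rintro _ ⟨y, hy, rfl⟩
      obtain ⟨w, hw, hyw⟩ := hAW y hy
      refine ⟨_, ⟨w, hw, rfl⟩, _, ⟨y - w, by simpa using hyw, rfl⟩, ?_⟩
      simp only [← map_add, add_sub_cancel]
    obtain ⟨_, ⟨w, hw, rfl⟩, _, ⟨b, hb, rfl⟩, hwb⟩ := closure_minimal hsub hcl hx
    simp only [← map_add] at hwb
    refine ⟨w, hw, ?_⟩
    rw [← (toWeakSpace ℝ X).injective hwb]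
    simpa using hb
  choose W hW w hwW hw using h'
  refine isCompact_iff_ultrafilter_le_nhds'.2 fun U hU => ?_
  classical
  -- Approximation by a point of `W n`; the value 0 off the weak closure of `A` is invisible to `U`.
  let p : ℕ → WeakSpace ℝ X → X := fun n y =>
    if hy : toWeakSpace ℝ X ((toWeakSpace ℝ X).symm y) ∈ closure (toWeakSpace ℝ X '' A)
    then w n _ hy else 0
  have hpW : ∀ n, ∀ᶠ y in U, p n y ∈ W n ∧ ‖(toWeakSpace ℝ X).symm y - p n y‖ ≤ 1 / (n + 1) := by
    intro n
    filter_upwards [hU] with y hy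
    have hy' : toWeakSpace ℝ X ((toWeakSpace ℝ X).symm y) ∈ closure (toWeakSpace ℝ X '' A) := by
      simpa using hy
    simp only [p, dif_pos hy']
    exact ⟨hwW n _ hy', hw n _ hy'⟩
  have hlim : ∀ n, ∃ x : X, Tendsto (fun y => toWeakSpace ℝ X (p n y)) U
      (𝓝 (toWeakSpace ℝ X x)) := by
    intro n
    obtain ⟨_, ⟨x, -, rfl⟩, hx⟩ := isCompact_iff_ultrafilter_le_nhds'.1 (hW n)
      (U.map fun y => toWeakSpace ℝ X (p n y)) (by
        rw [Ultrafilter.mem_map]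
        filter_upwards [hpW n] with y hy using ⟨_, hy.1, rfl⟩)
    exact ⟨x, hx⟩
  choose x hx using hlim
  have hdist : ∀ m n : ℕ, dist (x m) (x n) ≤ 1 / (m + 1) + 1 / (n + 1) := by
    intro m n
    have h1 := (hx m).sub (hx n)
    have h2 := (hball (1 / (m + 1) + 1 / (n + 1))).mem_of_tendsto h1 (by
      filter_upwards [hpW m, hpW n] with y hm hn
      refine ⟨p m y - p n y, ?_, map_sub _ _ _⟩
      rw [mem_closedBall_zero_iff, show p m y - p n y =
        ((toWeakSpace ℝ X).symm y - p n y) - ((toWeakSpace ℝ X).symm y - p m y) by abel]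
      exact (norm_sub_le _ _).trans (by linarith [hm.2, hn.2]))
    obtain ⟨b, hb, hbe⟩ := h2
    rw [← map_sub] at hbe
    rw [dist_eq_norm, ← (toWeakSpace ℝ X).injective hbe]
    simpa using hb
  have hlim0 := tendsto_one_div_add_atTop_nhds_zero_nat (𝕜 := ℝ)
  have hcauchy : CauchySeq x := by
    refine cauchySeq_of_le_tendsto_0 (fun n : ℕ => 1 / ((n : ℝ) + 1) + 1 / (n + 1))
      (fun m n N hm hn => (hdist m n).trans ?_) (by simpa using hlim0.add hlim0)
    gcongr
  obtain ⟨a, ha⟩ := cauchySeq_tendsto_of_complete hcauchy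
  have hUa : (U : Filter (WeakSpace ℝ X)) ≤ 𝓝 (toWeakSpace ℝ X a) := by
    have : Tendsto (fun y => toWeakSpace ℝ X ((toWeakSpace ℝ X).symm y)) U
        (𝓝 (toWeakSpace ℝ X a)) := by
      refine tendsto_toWeakSpace fun f => Metric.tendsto_nhds.2 fun ε hε => ?_
      have h1 : Tendsto (fun n : ℕ => ‖f‖ * (1 / ((n : ℝ) + 1)) + dist (f (x n)) (f a)) atTop
          (𝓝 0) := by
        have h2 := tendsto_iff_dist_tendsto_zero.1 ((f.continuous.tendsto a).comp ha)
        simpa using (hlim0.const_mul ‖f‖).add h2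
      obtain ⟨n, hn⟩ := (h1.eventually_lt_const (half_pos hε)).exists
      have h3 := ((continuous_weakSpace_apply f).tendsto _).comp (hx n)
      filter_upwards [hpW n, Metric.tendsto_nhds.1 h3 (ε / 2) (half_pos hε)] with y hy1 hy2
      simp only [Function.comp_apply, LinearEquiv.symm_apply_apply] at hy2
      have h4 : dist (f ((toWeakSpace ℝ X).symm y)) (f (p n y)) ≤ ‖f‖ * (1 / ((n : ℝ) + 1)) := by
        rw [dist_eq_norm, ← map_sub]
        exact f.le_opNorm_of_le hy1.2
      linarith [dist_triangle4 (f ((toWeakSpace ℝ X).symm y)) (f (p n y)) (f (x n)) (f a)]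
    simpa [Tendsto] using this
  exact ⟨_, isClosed_iff_ultrafilter.1 isClosed_closure _ U hUa hU, hUa⟩

end WeakCompactness

/-! ### Weak compactness of bounded L-weakly compact sets -/

section LwcSets

variable {E : Type*} [NormedAddCommGroup E] [NormedSpace ℝ E] [Lattice E] [BanachLattice E]

theorem abs_smul_of_nonneg {r : ℝ} (hr : 0 ≤ r) (a : E) : |r • a| = r • |a| := by
  have hle : ∀ {r : ℝ}, 0 ≤ r → ∀ a : E, |r • a| ≤ r • |a| := fun hr a =>
    abs_le'.2 ⟨smul_le_smul_of_nonneg_left (le_abs_self a) hr, by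
      rw [← smul_neg]
      exact smul_le_smul_of_nonneg_left (neg_le_abs a) hr⟩
  rcases hr.eq_or_lt with rfl | hr0
  · simp
  · refine le_antisymm (hle hr a) ?_
    have := smul_le_smul_of_nonneg_left (hle (inv_nonneg.2 hr) (r • a)) hr
    rwa [inv_smul_smul₀ hr0.ne', smul_inv_smul₀ hr0.ne'] at this

theorem convexOn_functional_abs_sub {f : StrongDual ℝ E} (hf : ∀ y, 0 ≤ y → 0 ≤ f y) (t : E) :
    ConvexOn ℝ Set.univ fun x => f |x - t| := by
  refine ⟨convex_univ, fun x _ y _ a b ha hb hab => ?_⟩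
  have h : |a • x + b • y - t| ≤ a • |x - t| + b • |y - t| := by
    rw [← abs_smul_of_nonneg ha, ← abs_smul_of_nonneg hb]
    refine le_trans (le_of_eq ?_) (abs_add_le _ _)
    congr 1
    rw [smul_sub, smul_sub, sub_add_sub_comm, ← add_smul, hab, one_smul]
  simpa using le_of_nonneg_functional hf h

theorem DisjointNull.hasConvexGaps {u : E} (hu0 : 0 ≤ u) (hu : DisjointNull u) :
    HasConvexGaps (Set.Icc 0 u) := by
  intro ε hε
  obtain ⟨f, hf, δ, hδ, hfδ⟩ := hu.exists_control hε
  -- The mesh error costs less than `δ / 2` under `f`, and the allowed gap is `δ / 4`, so `f |x - y|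
  -- < δ`.
  obtain ⟨n, hn⟩ := exists_nat_gt (2 * f u / (δ / 2))
  have hn0 : (0 : ℝ) < n := lt_of_le_of_lt (div_nonneg (mul_nonneg zero_le_two (hf u hu0))
    (by positivity)) hn
  have hfn : f ((2 : ℝ) • (n : ℝ)⁻¹ • u) < δ / 2 := by
    simp only [map_smul, smul_eq_mul]
    rw [div_lt_iff₀ (by positivity)] at hn
    rw [mul_left_comm, inv_mul_eq_div, div_lt_iff₀ hn0]
    linarith
  let t : ℕ → E := fun j => (j : ℝ) • (n : ℝ)⁻¹ • u
  have ht0 : ∀ j, 0 ≤ t j := fun j => by positivity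
  refine ⟨fun x => ∑ j ∈ Finset.range (n + 1), f |x - t j|, ?_, ?_, ?_, ?_, δ / 4, by positivity,
    fun x hx y hy hgap => ?_⟩
  · refine continuous_finsetSum _ fun j _ => f.continuous.comp ?_
    exact (continuous_id.sub continuous_const).sup (continuous_id.sub continuous_const).neg
  · have : ∀ s : Finset ℕ, ConvexOn ℝ Set.univ fun x => ∑ j ∈ s, f |x - t j| := by
      intro s
      induction s using Finset.cons_induction with
      | empty => simpa using convexOn_const (0 : ℝ) convex_univ
      | cons a s ha ih =>
        simp only [Finset.sum_cons]
        exact (convexOn_functional_abs_sub hf (t a)).add ih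
    exact this _
  · exact fun x => Finset.sum_nonneg fun j _ => hf _ (abs_nonneg _)
  · refine ⟨∑ j ∈ Finset.range (n + 1), f (u + t j), fun x hx =>
      Finset.sum_le_sum fun j _ => le_of_nonneg_functional hf (abs_le'.2 ⟨?_, ?_⟩)⟩
    · exact (sub_le_self x (ht0 j)).trans (hx.2.trans (le_add_of_nonneg_right (ht0 j)))
    · rw [neg_sub]
      exact (sub_le_self _ hx.1).trans (le_add_of_nonneg_left hu0)
  · have h1 := le_of_nonneg_functional hf
      (abs_sub_le_sum_grid hx.1 hy.1 hx.2 hy.2 (Nat.cast_pos.1 hn0))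
    rw [map_add, map_sum] at h1
    have h2 : ∀ j, f |x + y - (2 : ℝ) • t j| = 2 * f |midpoint ℝ x y - t j| := by
      intro j
      rw [← smul_eq_mul, ← map_smul, ← abs_smul_of_nonneg zero_le_two, smul_sub,
        midpoint_eq_smul_add, invOf_eq_inv, smul_inv_smul₀ two_ne_zero]
    have h3 : ∑ j ∈ Finset.range (n + 1), f (|x - t j| + |y - t j| - |x + y - (2 : ℝ) • t j|) =
        ∑ j ∈ Finset.range (n + 1), f |x - t j| + ∑ j ∈ Finset.range (n + 1), f |y - t j| -
          2 * ∑ j ∈ Finset.range (n + 1), f |midpoint ℝ x y - t j| := by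
      simp only [map_sub, map_add, h2, Finset.sum_sub_distrib, Finset.sum_add_distrib,
        Finset.mul_sum]
    have h4 : f |x - y| < δ := by
      simp only [t] at h3 hgap
      rw [h3] at h1
      linarith
    rw [dist_eq_norm, ← norm_abs_eq_norm]
    refine (hfδ _ (abs_nonneg _) (abs_le'.2 ⟨?_, ?_⟩) h4).le
    · exact (sub_le_self x hy.1).trans hx.2
    · rw [neg_sub]
      exact (sub_le_self y hx.1).trans hy.2

theorem DisjointNull.isCompact_Icc {u : E} (hu0 : 0 ≤ u) (hu : DisjointNull u) :
    IsCompact (toWeakSpace ℝ E '' Set.Icc 0 u) := by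
  refine (hu.hasConvexGaps hu0).isCompact_toWeakSpace isClosed_Icc ?_
  exact convex_Icc 0 u

theorem DisjointNull.isCompact_Icc_neg {u : E} (hu0 : 0 ≤ u) (hu : DisjointNull u) :
    IsCompact (toWeakSpace ℝ E '' Set.Icc (-u) u) := by
  have h := ((hu.add hu0 hu0 hu).isCompact_Icc (add_nonneg hu0 hu0)).image
    (continuous_sub_right (toWeakSpace ℝ E u))
  convert h using 1
  rw [Set.image_image]
  ext y
  constructor
  · rintro ⟨x, hx, rfl⟩
    exact ⟨x + u, ⟨neg_le_iff_add_nonneg.1 hx.1, by gcongr; exact hx.2⟩, by simp⟩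
  · rintro ⟨x, hx, rfl⟩
    refine ⟨x - u, ⟨by simpa using hx.1, sub_le_iff_le_add.2 hx.2⟩, by simp⟩

/-- Bounded L-weakly compact sets are relatively weakly compact. -/
theorem IsLwcSet.isRelativelyWeaklyCompact {A : Set E} (hA : IsLwcSet A)
    (hb : Bornology.IsBounded A) : IsRelativelyWeaklyCompact A := by
  refine isRelativelyWeaklyCompact_of_forall_near fun ε hε => ?_
  obtain ⟨u, hu0, hu, h⟩ := hA.exists_disjointNull hb (half_pos hε)
  -- Truncation of `x` at `±u`; each of the two parts loses at most `(|x| - u)⁺`.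
  refine ⟨Set.Icc (-u) u, hu.isCompact_Icc_neg hu0, fun x hx => ⟨x⁺ ⊓ u - x⁻ ⊓ u, ⟨?_, ?_⟩, ?_⟩⟩
  · rw [neg_le_sub_iff_le_add]
    exact inf_le_right.trans (le_add_of_nonneg_left (le_inf (posPart_nonneg x) hu0))
  · exact (sub_le_self _ (le_inf (negPart_nonneg x) hu0)).trans inf_le_right
  · have hpos : ‖x⁺ - x⁺ ⊓ u‖ ≤ ε / 2 := by
      rw [sub_inf_eq_posPart]
      refine (norm_le_norm_of_nonneg_of_le (posPart_nonneg _)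
        (posPart_mono (sub_le_sub_right ?_ u))).trans (h x hx).le
      exact sup_le (le_abs_self x) (abs_nonneg x)
    have hneg : ‖x⁻ - x⁻ ⊓ u‖ ≤ ε / 2 := by
      rw [sub_inf_eq_posPart]
      refine (norm_le_norm_of_nonneg_of_le (posPart_nonneg _)
        (posPart_mono (sub_le_sub_right ?_ u))).trans (h x hx).le
      exact sup_le (neg_le_abs x) (abs_nonneg x)
    have heq : x - (x⁺ ⊓ u - x⁻ ⊓ u) = (x⁺ - x⁺ ⊓ u) - (x⁻ - x⁻ ⊓ u) := by
      nth_rw 1 [← posPart_sub_negPart x]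
      abel
    rw [heq]
    exact (norm_sub_le _ _).trans (by linarith)

omit [NormedSpace ℝ E] [BanachLattice E] in
theorem IsLwcSet.mono {A B : Set E} (hB : IsLwcSet B) (h : A ⊆ B) : IsLwcSet A :=
  fun a ha hd => hB a (fun n => let ⟨x, hx, hax⟩ := ha n; ⟨x, h hx, hax⟩) hd

end LwcSets

/-! ### The three inclusions and stability of limited sets -/

section Inclusions

variable {X F : Type*} [NormedAddCommGroup X] [NormedSpace ℝ X] [NormedAddCommGroup F]
  [NormedSpace ℝ F] [Lattice F] [BanachLattice F]

theorem lwc_subset_biLLwc : Lwc X F ⊆ BiLLwc X F := by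
  intro T hT A hA a ha hd
  obtain ⟨r, hr, hAr⟩ := hA.1.exists_pos_norm_le
  have hT' : IsLwcSet (T '' Metric.closedBall 0 1) := hT
  have h := hT' (fun n => r⁻¹ • a n) (fun n => ?_) fun m n hmn => ?_
  · simpa [smul_smul, hr.ne'] using h.const_smul r
  · obtain ⟨_, ⟨x, hx, rfl⟩, hax⟩ := ha n
    refine ⟨T (r⁻¹ • x), ⟨r⁻¹ • x, ?_, rfl⟩, ?_⟩
    · rw [mem_closedBall_zero_iff, norm_smul, norm_inv, Real.norm_of_nonneg hr.le,
        inv_mul_le_one₀ hr]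
      exact hAr x hx
    · rw [map_smul, abs_smul_of_nonneg (by positivity), abs_smul_of_nonneg (by positivity)]
      exact smul_le_smul_of_nonneg_left hax (by positivity)
  · rw [abs_smul_of_nonneg (by positivity), abs_smul_of_nonneg (by positivity)]
    refine le_antisymm ?_ (le_inf (by positivity) (by positivity))
    have h2 : r • (r⁻¹ • |a m| ⊓ r⁻¹ • |a n|) ≤ 0 := by
      rw [← hd m n hmn]
      refine le_inf ?_ ?_
      · simpa [hr.ne'] using smul_le_smul_of_nonneg_left
          (inf_le_left : r⁻¹ • |a m| ⊓ r⁻¹ • |a n| ≤ _) hr.le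
      · simpa [hr.ne'] using smul_le_smul_of_nonneg_left
          (inf_le_right : r⁻¹ • |a m| ⊓ r⁻¹ • |a n| ≤ _) hr.le
    simpa [hr.ne'] using smul_le_smul_of_nonneg_left h2 (inv_nonneg.2 hr.le)

omit [NormedSpace ℝ F] [Lattice F] [BanachLattice F] in
theorem isWeakStarNull_iff {f : ℕ → StrongDual ℝ X} :
    IsWeakStarNull f ↔ ∀ x, Tendsto (fun n => f n x) atTop (𝓝 0) := by
  have hind : Topology.IsInducing (fun (g : WeakDual ℝ X) (x : X) => g x) := ⟨rfl⟩
  exact hind.tendsto_nhds_iff.trans tendsto_pi_nhds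

theorem isBiLimited_iff {A : Set X} :
    IsBiLimited A ↔ IsLimited (NormedSpace.inclusionInDoubleDual ℝ X '' A) := by
  unfold IsBiLimited IsLimited
  refine and_congr ⟨fun h => ?_, fun h => ?_⟩ (forall₂_congr fun f _ => ?_)
  · obtain ⟨C, hC⟩ := h.exists_norm_le
    refine isBounded_iff_forall_norm_le.2 ⟨C, ?_⟩
    rintro _ ⟨x, hx, rfl⟩
    exact (NormedSpace.double_dual_bound ℝ X x).trans (hC x hx)
  · obtain ⟨C, hC⟩ := h.exists_norm_le
    refine isBounded_iff_forall_norm_le.2 ⟨C, fun x hx => ?_⟩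
    have := hC _ ⟨x, hx, rfl⟩
    rwa [show ‖NormedSpace.inclusionInDoubleDual ℝ X x‖ = ‖x‖ from
      (NormedSpace.inclusionInDoubleDualLi ℝ (E := X)).norm_map x] at this
  · simp only [Metric.tendstoUniformlyOn_iff, Set.forall_mem_image]

theorem IsLimited.image {Y : Type*} [NormedAddCommGroup Y] [NormedSpace ℝ Y] {A : Set X}
    (hA : IsLimited A) (T : X →L[ℝ] Y) : IsLimited (T '' A) := by
  refine ⟨T.lipschitz.isBounded_image hA.1, fun f hf => ?_⟩
  have := hA.2 (fun n => (f n).comp T) (isWeakStarNull_iff.2 fun x =>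
    isWeakStarNull_iff.1 hf (T x))
  rw [Metric.tendstoUniformlyOn_iff] at this ⊢
  simp only [Set.forall_mem_image]
  exact this

theorem IsLimited.isBiLimited {A : Set X} (hA : IsLimited A) : IsBiLimited A :=
  isBiLimited_iff.2 (hA.image _)

/-- The Banach space adjoint of a bounded operator. -/
def adjointMap {Y : Type*} [NormedAddCommGroup Y] [NormedSpace ℝ Y] (T : X →L[ℝ] Y) :
    StrongDual ℝ Y →L[ℝ] StrongDual ℝ X :=
  (ContinuousLinearMap.compL ℝ X Y ℝ).flip T

/-- The second adjoint extends `T` to the biduals, so the claim reduces to images of limited sets.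
-/
theorem IsBiLimited.image {Y : Type*} [NormedAddCommGroup Y] [NormedSpace ℝ Y] {A : Set X}
    (hA : IsBiLimited A) (T : X →L[ℝ] Y) : IsBiLimited (T '' A) := by
  have h := (isBiLimited_iff.1 hA).image
    (adjointMap (adjointMap T))
  rw [isBiLimited_iff]
  convert h using 1
  simp only [Set.image_image]
  rfl

theorem biLLwc_subset_lLwc : BiLLwc X F ⊆ LLwc X F := fun _ hT A hA => hT A hA.isBiLimited

theorem lLwc_subset_bd : LLwc X F ⊆ BD X F := fun T hT A hA =>
  (hT A hA).isRelativelyWeaklyCompact (T.lipschitz.isBounded_image hA.1)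

end Inclusions

/-! ### The identity of `ℓ²` -/

section SequenceSpaces

theorem exists_strictMono_le_norm {E : Type*} [NormedAddCommGroup E] {a : ℕ → E}
    (h : ¬ Tendsto a atTop (𝓝 0)) :
    ∃ ε > 0, ∃ φ : ℕ → ℕ, StrictMono φ ∧ ∀ n, ε ≤ ‖a (φ n)‖ := by
  simp only [Metric.tendsto_atTop, dist_zero_right, not_forall, not_exists, not_lt] at h
  obtain ⟨ε, hε, h⟩ := h
  refine ⟨ε, hε, extraction_of_frequently_atTop (P := fun n => ε ≤ ‖a n‖)
    (frequently_atTop.2 fun N => ?_)⟩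
  obtain ⟨n, hn, hnε⟩ := h N
  exact ⟨n, hn, hnε⟩

theorem IsLimited.exists_forall_abs_lt {X : Type*} [NormedAddCommGroup X] [NormedSpace ℝ X]
    {A : Set X} (hA : IsLimited A) {f : ℕ → StrongDual ℝ X}
    (hf : ∀ x, Tendsto (fun n => f n x) atTop (𝓝 0)) {ε : ℝ} (hε : 0 < ε) :
    ∃ N, ∀ n ≥ N, ∀ x ∈ A, |f n x| < ε := by
  have := Metric.tendstoUniformlyOn_iff.1 (hA.2 f (isWeakStarNull_iff.2 hf)) ε hε
  simpa using this

theorem not_isLwcSet_of_disjoint {E : Type*} [NormedAddCommGroup E] [Lattice E]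
    {A : Set E} (e : ℕ → E) (he : ∀ n, ‖e n‖ = 1)
    (hd : ∀ m n, m ≠ n → |e m| ⊓ |e n| = 0)
    (hA : ∀ n, e n ∈ LatticeOrderedAddCommGroup.solidClosure A) : ¬ IsLwcSet A := by
  intro h
  have := (h e hA hd).norm
  simp [he] at this

theorem EllTwo.abs_apply (f : EllTwo) (n : ℕ) : |f| n = |f n| := rfl

theorem EllTwo.inf_apply (f g : EllTwo) (n : ℕ) : (f ⊓ g) n = f n ⊓ g n := rfl

theorem id_notMem_lwc_ellTwo : ContinuousLinearMap.id ℝ EllTwo ∉ Lwc EllTwo EllTwo := by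
  refine not_isLwcSet_of_disjoint (fun n => lp.single 2 n (1 : ℝ)) (fun n => ?_)
    (fun m n hmn => ?_) (fun n => ⟨lp.single 2 n (1 : ℝ), ⟨lp.single 2 n (1 : ℝ), ?_, rfl⟩, le_rfl⟩)
  · rw [lp.norm_single (by norm_num), norm_one]
  · ext k
    rw [EllTwo.inf_apply, EllTwo.abs_apply, EllTwo.abs_apply, lp.single_apply, lp.single_apply]
    by_cases h : k = m
    · subst h
      simp [hmn]
    · simp [Pi.single_apply, h]
  · rw [mem_closedBall_zero_iff, lp.norm_single (by norm_num), norm_one]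

/-- Orthonormal sequences in a Hilbert space define weakly null sequences of functionals. -/
theorem tendsto_bidual_of_orthonormal {H : Type*} [NormedAddCommGroup H] [InnerProductSpace ℝ H]
    [CompleteSpace H] {e : ℕ → H} (he : Orthonormal ℝ e)
    (ξ : StrongDual ℝ (StrongDual ℝ H)) :
    Tendsto (fun n => ξ (innerSL ℝ (e n))) atTop (𝓝 0) := by
  obtain ⟨z, hz⟩ := (InnerProductSpace.toDual ℝ H).surjective (ξ.comp (innerSL ℝ))
  have h : ∀ n, ξ (innerSL ℝ (e n)) = inner ℝ (e n) z := fun n => by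
    rw [real_inner_comm]
    exact (congrArg (fun f : StrongDual ℝ H => f (e n)) hz).symm
  simp only [h]
  have h2 := (he.inner_products_summable z).tendsto_atTop_zero.sqrt
  rw [tendsto_zero_iff_norm_tendsto_zero]
  simpa [Real.sqrt_sq_eq_abs] using h2

theorem IsBiLimited.isLwcSet_ellTwo {A : Set EllTwo} (hA : IsBiLimited A) : IsLwcSet A := by
  intro a ha hd
  by_contra H
  obtain ⟨ε, hε, φ, hφ, hφε⟩ := exists_strictMono_le_norm H
  choose x hxA hax using ha
  have hak : ∀ n k, |a n k| ≤ |x n k| := fun n k => hax n k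
  -- The moduli of `a n` with the signs of `x n`: these vectors stay disjoint, hence orthogonal, and
  -- satisfy `⟨s n, x n⟩ ≥ ‖a n‖ ^ 2` because `|a n| ≤ |x n|`.
  let s : ℕ → EllTwo := fun n => ⟨fun k => SignType.sign (x n k) * |a n k|,
    (lp.memℓp (a n)).mono' fun k => by
      rcases lt_trichotomy (x n k) 0 with h | h | h <;> simp [h]⟩
  have hsk : ∀ n k, s n k = SignType.sign (x n k) * |a n k| := fun n k => rfl
  have hsabs : ∀ n k, ‖s n k‖ = ‖a n k‖ := by
    intro n k
    have h0 := hak n k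
    rw [hsk]
    rcases lt_trichotomy (x n k) 0 with h | h | h
    · simp [h]
    · simp only [h, abs_zero, abs_nonpos_iff] at h0
      simp [h, h0]
    · simp [h]
  have hsn : ∀ n, ‖s n‖ = ‖a n‖ := fun n =>
    le_antisymm (lp.norm_mono (by norm_num) fun k => (hsabs n k).le)
      (lp.norm_mono (by norm_num) fun k => (hsabs n k).ge)
  have hsx : ∀ n, ‖a n‖ ^ 2 ≤ inner ℝ (s n) (x n) := by
    intro n
    rw [← real_inner_self_eq_norm_sq]
    refine hasSum_le (fun k => ?_) (lp.hasSum_inner (𝕜 := ℝ) (a n) (a n))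
      (lp.hasSum_inner (𝕜 := ℝ) (s n) (x n))
    have h0 := hak n k
    simp only [RCLike.inner_apply, conj_trivial, hsk]
    rw [← mul_assoc, self_mul_sign, ← abs_mul_abs_self (a n k)]
    gcongr
  have hss : ∀ m n, m ≠ n → inner ℝ (s m) (s n) = (0 : ℝ) := by
    intro m n hmn
    refine (lp.hasSum_inner (𝕜 := ℝ) (s m) (s n)).unique ?_
    convert hasSum_zero using 2 with k
    have h0 : |a m k| ⊓ |a n k| = 0 := by
      have := congrArg (fun f : EllTwo => f k) (hd m n hmn)
      simpa [EllTwo.inf_apply, EllTwo.abs_apply] using this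
    simp only [RCLike.inner_apply, conj_trivial, hsk]
    rcases min_choice |a m k| |a n k| with h | h <;> rw [h] at h0 <;> simp [h0]
  have hpos : ∀ n, 0 < ‖a (φ n)‖ := fun n => hε.trans_le (hφε n)
  let e : ℕ → EllTwo := fun n => ‖a (φ n)‖⁻¹ • s (φ n)
  have he : Orthonormal ℝ e := by
    refine ⟨fun n => ?_, fun m n hmn => ?_⟩
    · rw [norm_smul, norm_inv, norm_norm, hsn, inv_mul_cancel₀ (hpos n).ne']
    · simp only [e, real_inner_smul_left, real_inner_smul_right, hss _ _ (hφ.injective.ne hmn),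
        mul_zero]
  -- The `e n`, viewed as functionals and embedded in the third dual, are weak-star null, so they
  -- must be uniformly small on `A`.
  obtain ⟨N, hN⟩ := (isBiLimited_iff.1 hA).exists_forall_abs_lt
    (f := fun n => NormedSpace.inclusionInDoubleDual ℝ (StrongDual ℝ EllTwo) (innerSL ℝ (e n)))
    (fun ξ => tendsto_bidual_of_orthonormal he ξ) hε
  have h1 : |inner ℝ (e N) (x (φ N))| < ε := hN N le_rfl _ ⟨_, hxA _, rfl⟩
  refine absurd h1 (not_lt.2 ((hφε N).trans (le_trans ?_ (le_abs_self _))))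
  rw [real_inner_smul_left, ← div_eq_inv_mul, le_div_iff₀ (hpos N), ← sq]
  exact hsx _

theorem id_mem_biLLwc_ellTwo : ContinuousLinearMap.id ℝ EllTwo ∈ BiLLwc EllTwo EllTwo :=
  fun A hA => by
    rw [show ContinuousLinearMap.id ℝ EllTwo '' A = A from Set.image_id A]
    exact hA.isLwcSet_ellTwo

end SequenceSpaces

/-! ### Phillips' lemma for bounded sequences -/

section Phillips

open scoped BoundedContinuousFunction

/-- The indicator of a set of natural numbers, as a bounded sequence. -/
def indSeq (S : Set ℕ) : ℕ →ᵇ ℝ :=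
  BoundedContinuousFunction.ofNormedAddCommGroup (S.indicator 1) continuous_of_discreteTopology 1
    fun n => by
      by_cases h : n ∈ S <;> simp [h]

theorem indSeq_apply (S : Set ℕ) (n : ℕ) : indSeq S n = S.indicator 1 n := rfl

theorem indSeq_union {S T : Set ℕ} (h : Disjoint S T) :
    indSeq (S ∪ T) = indSeq S + indSeq T := by
  ext n
  exact congrFun (Set.indicator_union_of_disjoint h 1) n

/-- Signed sums of indicators of pairwise disjoint sets have norm at most one. -/
theorem norm_sum_sign_indSeq_le {ι : Type*} (s : Finset ι) (T : ι → Set ℕ)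
    (hT : Pairwise fun i j => Disjoint (T i) (T j)) (σ : ι → ℝ) (hσ : ∀ i, |σ i| ≤ 1) :
    ‖∑ i ∈ s, σ i • indSeq (T i)‖ ≤ 1 := by
  refine (BoundedContinuousFunction.norm_le zero_le_one).2 fun n => ?_
  simp only [BoundedContinuousFunction.coe_sum, Finset.sum_apply,
    BoundedContinuousFunction.coe_smul, indSeq_apply, smul_eq_mul]
  by_cases h : ∃ i ∈ s, n ∈ T i
  · obtain ⟨i, hi, hn⟩ := h
    rw [Finset.sum_eq_single_of_mem i hi]
    · simpa [hn] using hσ i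
    · intro j _ hji
      rw [Set.indicator_of_notMem (fun hj => Set.disjoint_left.1 (hT hji) hj hn), mul_zero]
  · rw [Finset.sum_eq_zero]
    · simp
    · intro i hi
      rw [Set.indicator_of_notMem (fun hn => h ⟨i, hi, hn⟩), mul_zero]

theorem sum_abs_indSeq_le {ι : Type*} (s : Finset ι) (T : ι → Set ℕ)
    (hT : Pairwise fun i j => Disjoint (T i) (T j)) (η : StrongDual ℝ (ℕ →ᵇ ℝ)) :
    ∑ i ∈ s, |η (indSeq (T i))| ≤ ‖η‖ := by
  have h1 : ∑ i ∈ s, |η (indSeq (T i))| =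
      η (∑ i ∈ s, (SignType.sign (η (indSeq (T i))) : ℝ) • indSeq (T i)) := by
    simp [map_sum, sign_mul_self]
  rw [h1]
  refine (le_abs_self _).trans ((η.le_opNorm _).trans (mul_le_of_le_one_right (norm_nonneg _) ?_))
  refine norm_sum_sign_indSeq_le s T hT _ fun i => ?_
  rcases lt_trichotomy (η (indSeq (T i))) 0 with h | h | h <;> simp [h]

/-- Inside every infinite set of naturals there is an infinite set on which the variation of a
given functional on bounded sequences is small. -/
theorem exists_infinite_subset_small (η : StrongDual ℝ (ℕ →ᵇ ℝ)) {κ : ℕ → ℕ}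
    (hκ : Function.Injective κ) {S : Set ℕ} (hS : S.Infinite) {δ : ℝ} (hδ : 0 < δ) :
    ∃ S' ⊆ S, S'.Infinite ∧ ∀ T ⊆ S', |η (indSeq (κ '' T))| ≤ δ := by
  by_contra! H
  let σ : ℕ → ℕ := Nat.nth (· ∈ S)
  have hσi : Function.Injective σ := Nat.nth_injective hS
  have hσS : ∀ n, σ n ∈ S := Nat.nth_mem_of_infinite hS
  -- A partition of `S` into infinitely many infinite parts. If each contained a set with value
  -- above `δ`, the disjoint images under `κ` would exceed the total variation `‖η‖`.
  let P : ℕ → Set ℕ := fun i => σ '' {n | (Nat.unpair n).1 = i}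
  have hPinf : ∀ i, (P i).Infinite := by
    intro i
    refine Set.Infinite.image hσi.injOn ?_
    refine Set.infinite_of_injective_forall_mem (f := fun q => Nat.pair i q) ?_ (by simp)
    intro p q h
    simpa using h
  have hPS : ∀ i, P i ⊆ S := by
    rintro i _ ⟨n, -, rfl⟩
    exact hσS n
  choose T hTP hT using fun i => H (P i) (hPS i) (hPinf i)
  have hdisj : Pairwise fun i j => Disjoint (κ '' T i) (κ '' T j) := by
    intro i j hij
    rw [Set.disjoint_image_iff hκ]
    refine Set.disjoint_of_subset (hTP i) (hTP j) ?_
    rw [Set.disjoint_image_iff hσi, Set.disjoint_left]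
    rintro n rfl h
    exact hij h
  obtain ⟨p, hp⟩ := exists_nat_gt (‖η‖ / δ)
  rw [div_lt_iff₀ hδ] at hp
  have h1 := sum_abs_indSeq_le (Finset.range p) _ hdisj η
  have h2 := Finset.card_nsmul_le_sum (Finset.range p) (fun i => |η (indSeq (κ '' T i))|) δ
    fun i _ => (hT i).le
  rw [Finset.card_range, nsmul_eq_mul] at h2
  linarith

/-- A decreasing sequence of tails of one infinite set along which the variations of countably
many functionals are small. -/
theorem exists_strictMono_small (η : ℕ → StrongDual ℝ (ℕ →ᵇ ℝ)) {κ : ℕ → ℕ}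
    (hκ : Function.Injective κ) {δ : ℝ} (hδ : 0 < δ) :
    ∃ m : ℕ → ℕ, StrictMono m ∧ ∀ j, |η (m j) (indSeq (κ '' (m '' Set.Ioi j)))| ≤ δ := by
  have hstep : ∀ S : {S : Set ℕ // S.Infinite}, ∃ S' : {S : Set ℕ // S.Infinite},
      S'.1 ⊆ S.1 ∧ (∀ k ∈ S'.1, sInf S.1 < k) ∧
        ∀ T ⊆ S'.1, |η (sInf S.1) (indSeq (κ '' T))| ≤ δ := by
    intro S
    -- Discarding the minimum makes the successive minima, which form the sequence `m`, strictly
    -- increasing.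
    have hinf : (S.1 \ Set.Iic (sInf S.1)).Infinite := S.2.sdiff (Set.finite_Iic _)
    obtain ⟨S', hS', hS'i, hsmall⟩ := exists_infinite_subset_small (η (sInf S.1)) hκ hinf hδ
    exact ⟨⟨S', hS'i⟩, fun k hk => (hS' hk).1, fun k hk => not_le.1 (hS' hk).2, hsmall⟩
  choose G hGsub hGlt hGsmall using hstep
  let S : ℕ → {S : Set ℕ // S.Infinite} := fun n => G^[n] ⟨Set.univ, Set.infinite_univ⟩
  have hS : ∀ n, S (n + 1) = G (S n) := fun n => Function.iterate_succ_apply' G n _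
  have hanti : Antitone fun n => (S n).1 := antitone_nat_of_succ_le fun n => by
    rw [hS]
    exact hGsub _
  have hmem : ∀ n, sInf (S n).1 ∈ (S n).1 := fun n => Nat.sInf_mem (S n).2.nonempty
  refine ⟨fun n => sInf (S n).1, strictMono_nat_of_lt_succ fun n => ?_, fun j => ?_⟩
  · refine hGlt (S n) _ ?_
    rw [← hS]
    exact hmem _
  · refine hGsmall (S j) _ ?_
    rintro _ ⟨i, hi, rfl⟩
    rw [← hS]
    exact hanti (Nat.succ_le_of_lt hi) (hmem i)

/-- Phillips' lemma for the unit vectors. -/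
theorem isLimited_range_indSeq_singleton :
    IsLimited (Set.range fun k : ℕ => indSeq {k}) := by
  constructor
  · refine isBounded_iff_forall_norm_le.2 ⟨1, ?_⟩
    rintro _ ⟨k, rfl⟩
    have := norm_sum_sign_indSeq_le (Finset.univ : Finset Unit) (fun _ => {k})
      (fun i j hij => (hij rfl).elim) (fun _ => 1) (by simp)
    simpa using this
  intro ξ hξ
  rw [isWeakStarNull_iff] at hξ
  rw [Metric.tendstoUniformlyOn_iff]
  by_contra! H
  obtain ⟨ε, hε, H⟩ := H
  simp only [Set.exists_range_iff, dist_zero_left, Real.norm_eq_abs] at H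
  -- Gliding hump: each triple holds the index of a functional, a coordinate where it is large, and
  -- a label; later functionals are small at earlier coordinates.
  obtain ⟨p, hp, hpr⟩ := exists_seq_of_forall_finset_exists
    (fun p : ℕ × ℕ × ℕ => ε ≤ |ξ p.1 (indSeq {p.2.1})|)
    (fun p q => p.1 < q.1 ∧ p.2.2 < q.2.2 ∧ p.2.1 ≠ q.2.1 ∧
      |ξ q.1 (indSeq {p.2.1})| ≤ ε / 8 * (1 / 2) ^ p.2.2) (by
    intro s _
    have h1 : ∀ᶠ n in atTop, ∀ p ∈ s, |ξ n (indSeq {p.2.1})| < ε ∧ p.1 < n ∧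
        |ξ n (indSeq {p.2.1})| ≤ ε / 8 * (1 / 2) ^ p.2.2 := by
      rw [eventually_all_finset]
      intro p _
      have := (hξ (indSeq {p.2.1})).abs
      rw [abs_zero] at this
      filter_upwards [this.eventually_lt_const hε, eventually_gt_atTop p.1,
        this.eventually_le_const (by positivity : 0 < ε / 8 * (1 / 2) ^ p.2.2)]
        with n h1 h2 h3 using ⟨h1, h2, h3⟩
    obtain ⟨n, ⟨k, hk⟩, hn⟩ := (H.and_eventually h1).exists
    refine ⟨(n, k, s.sup (fun p => p.2.2) + 1), hk, fun q hq => ⟨(hn q hq).2.1,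
      Nat.lt_succ_of_le (Finset.le_sup (f := fun p => p.2.2) hq), ?_, (hn q hq).2.2⟩⟩
    rintro rfl
    exact absurd hk (not_le.2 (hn q hq).1))
  let κ : ℕ → ℕ := fun j => (p j).2.1
  let η : ℕ → StrongDual ℝ (ℕ →ᵇ ℝ) := fun j => ξ (p j).1
  have hκ : Function.Injective κ := by
    intro i j hij
    by_contra hne
    rcases Ne.lt_or_gt hne with h | h
    · exact (hpr i j h).2.2.1 hij
    · exact (hpr j i h).2.2.1 hij.symm
  have hlab : ∀ n, n ≤ (p n).2.2 := fun _ =>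
    (strictMono_nat_of_lt_succ fun n => (hpr n (n + 1) n.lt_succ_self).2.1).le_apply
  have hηκ : ∀ j, ε ≤ |η j (indSeq {κ j})| := hp
  have hηsmall : ∀ i j, i < j → |η j (indSeq {κ i})| ≤ ε / 8 * (1 / 2) ^ i := fun i j hij =>
    (hpr i j hij).2.2.2.trans (mul_le_mul_of_nonneg_left
      (pow_le_pow_of_le_one (by norm_num) (by norm_num) (hlab i)) (by positivity))
  have hη0 : ∀ g, Tendsto (fun j => η j g) atTop (𝓝 0) := fun g =>
    (hξ g).comp (strictMono_nat_of_lt_succ fun n => (hpr n (n + 1) n.lt_succ_self).1).tendsto_atTop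
  obtain ⟨m, hm, hsmall⟩ := exists_strictMono_small η hκ (by positivity : 0 < ε / 4)
  have hsplit : ∀ j, indSeq (κ '' (m '' Set.Ici j)) =
      indSeq {κ (m j)} + indSeq (κ '' (m '' Set.Ioi j)) := by
    intro j
    rw [← indSeq_union]
    · rw [← Set.Ioi_insert, Set.image_insert_eq, Set.image_insert_eq, Set.singleton_union]
    · rw [Set.disjoint_singleton_left, Set.image_image]
      rintro ⟨i, hi, h⟩
      exact (ne_of_gt hi) (hm.injective (hκ h))
  have hsum : ∀ j, indSeq (κ '' (m '' Set.Ici 0)) =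
      ∑ i ∈ Finset.range j, indSeq {κ (m i)} + indSeq (κ '' (m '' Set.Ici j)) := by
    intro j
    induction j with
    | zero => simp
    | succ j ih =>
      rw [ih, hsplit j, Finset.sum_range_succ, add_assoc]
      congr 4
  set g := indSeq (κ '' (m '' Set.Ici 0))
  -- At `g`, the earlier coordinates contribute at most `ε / 4`, the coordinate `m j` at least `ε`,
  -- and the later ones at most `ε / 4`.
  have hlow : ∀ j, ε / 2 ≤ |η (m j) g| := by
    intro j
    have h1 : |η (m j) (∑ i ∈ Finset.range j, indSeq {κ (m i)})| ≤ ε / 4 := by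
      rw [map_sum]
      refine (Finset.abs_sum_le_sum_abs _ _).trans ?_
      refine (Finset.sum_le_sum (g := fun i => ε / 8 * (1 / 2) ^ i) fun i hi => ?_).trans ?_
      · refine (hηsmall (m i) (m j) (hm (Finset.mem_range.1 hi))).trans ?_
        exact mul_le_mul_of_nonneg_left
          (pow_le_pow_of_le_one (by norm_num) (by norm_num) hm.le_apply) (by positivity)
      · rw [← Finset.mul_sum]
        have h3 := Summable.sum_le_tsum (Finset.range j) (fun i _ => by positivity)
          summable_geometric_two
        rw [tsum_geometric_two] at h3
        have := mul_le_mul_of_nonneg_left h3 (by positivity : 0 ≤ ε / 8)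
        linarith
    have h2 : η (m j) (indSeq {κ (m j)}) = η (m j) g -
        η (m j) (∑ i ∈ Finset.range j, indSeq {κ (m i)}) -
        η (m j) (indSeq (κ '' (m '' Set.Ioi j))) := by
      rw [hsum j, hsplit j, map_add, map_add]
      ring
    have h3 := hηκ (m j)
    rw [h2] at h3
    have h4 := hsmall j
    rw [abs_le] at h1 h4
    rcases le_abs.1 h3 with h | h
    · exact le_abs.2 (Or.inl (by linarith))
    · exact le_abs.2 (Or.inr (by linarith))
  have := ge_of_tendsto' ((hη0 g).comp hm.tendsto_atTop).abs hlow
  rw [abs_zero] at this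
  linarith

end Phillips

/-! ### The identities of `c₀` and `c` -/

section NullAndConvergent

theorem isCompact_toWeakSpace_image_closedBall {X : Type*} [NormedAddCommGroup X]
    [NormedSpace ℝ X] {N : ℕ} (a : Fin N → X) (b : X) (r : ℝ) :
    IsCompact (toWeakSpace ℝ X '' ((fun v : (Fin N → ℝ) × ℝ => ∑ i, v.1 i • a i + v.2 • b) ''
      Metric.closedBall 0 r)) :=
  ((isCompact_closedBall _ _).image (by fun_prop)).image (toWeakSpaceCLM ℝ X).continuous

/-- The dual of a normed space, for the topology given by its norm. -/
abbrev NormDual (X : Type*) [NormedAddCommGroup X] [NormedSpace ℝ X] : Type _ := StrongDual ℝ X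

theorem exists_normDual {X : Type*} [NormedAddCommGroup X] [NormedSpace ℝ X] (l : X → ℝ)
    (hadd : ∀ x y, l (x + y) = l x + l y) (hsmul : ∀ (r : ℝ) x, l (r • x) = r * l x)
    (hl : ∀ x, |l x| ≤ ‖x‖) : ∃ f : NormDual X, ∀ x, f x = l x :=
  ⟨LinearMap.mkContinuous { toFun := l, map_add' := hadd, map_smul' := hsmul } 1
    fun x => (hl x).trans_eq (one_mul _).symm, fun _ => rfl⟩

theorem IsLimited.exists_pos_norm_le {X : Type*} [NormedAddCommGroup X] [NormedSpace ℝ X]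
    {A : Set X} (hA : IsLimited A) : ∃ r > 0, ∀ x ∈ A, ‖x‖ ≤ r :=
  hA.1.exists_pos_norm_le

open scoped BoundedContinuousFunction

theorem norm_indSeq_singleton (k : ℕ) : ‖indSeq {k}‖ = 1 := by
  refine le_antisymm ((BoundedContinuousFunction.norm_le zero_le_one).2 fun n => ?_) ?_
  · by_cases h : n = k <;> simp [indSeq_apply, h]
  · have := (indSeq {k}).norm_coe_le_norm k
    simpa [indSeq_apply] using this

theorem abs_indSeq_inf_abs_indSeq {m n : ℕ} (h : m ≠ n) :
    |indSeq {m}| ⊓ |indSeq {n}| = 0 := by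
  ext k
  change |indSeq {m} k| ⊓ |indSeq {n} k| = 0
  simp only [indSeq_apply]
  by_cases hk : k = m
  · subst hk
    simp [h]
  · simp [hk]

theorem tendsto_indSeq_singleton (k : ℕ) : Tendsto (indSeq {k}) atTop (𝓝 0) := by
  refine tendsto_const_nhds.congr' ?_
  filter_upwards [eventually_gt_atTop k] with n hn
  simp [indSeq_apply, hn.ne']

/-- The unit vectors of `c₀`. -/
def unitNull (k : ℕ) : SeqCZero := ⟨indSeq {k}, tendsto_indSeq_singleton k⟩

/-- The unit vectors of `c`. -/
def unitConv (k : ℕ) : SeqC := ⟨indSeq {k}, 0, tendsto_indSeq_singleton k⟩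

/-- Large coordinates of disjoint elements sit at distinct places, and the evaluations at distinct
places form a weak-star null sequence. -/
theorem IsLimited.isLwcSet_nullSeq {A : Set SeqCZero} (hA : IsLimited A) : IsLwcSet A := by
  intro a ha hd
  by_contra H
  obtain ⟨ε, hε, φ, hφ, hφε⟩ := exists_strictMono_le_norm H
  choose x hxA hax using ha
  have hex : ∀ n, ∃ k, ε / 2 < |(a (φ n)).1 k| := by
    intro n
    by_contra! h
    have := ((BoundedContinuousFunction.norm_le (half_pos hε).le).2 h : ‖(a (φ n)).1‖ ≤ ε / 2)
    have h2 : ε ≤ ‖(a (φ n)).1‖ := hφε n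
    linarith
  choose k hk using hex
  have hkinj : Function.Injective k := by
    intro m n hmn
    by_contra hne
    have h0 : |(a (φ m)).1 (k m)| ⊓ |(a (φ n)).1 (k m)| = 0 :=
      congrArg (fun f : SeqCZero => f.1 (k m)) (hd _ _ (hφ.injective.ne hne))
    have h1 := hk m
    have h2 := hk n
    rw [← hmn] at h2
    have := lt_inf_iff.2 ⟨h1, h2⟩
    rw [h0] at this
    linarith
  obtain ⟨N, hN⟩ := hA.exists_forall_abs_lt
    (f := fun n => (BoundedContinuousFunction.evalCLM ℝ (k n)).comp nullSeq.subtypeL)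
    (fun y => (show Tendsto y.1 atTop (𝓝 0) from y.2).comp hkinj.nat_tendsto_atTop)
    (half_pos hε)
  have h1 : |(x (φ N)).1 (k N)| < ε / 2 := hN N le_rfl _ (hxA _)
  have h2 : |(a (φ N)).1 (k N)| ≤ |(x (φ N)).1 (k N)| := hax (φ N) (k N)
  linarith [hk N]

theorem id_mem_lLwc_nullSeq : ContinuousLinearMap.id ℝ SeqCZero ∈ LLwc SeqCZero SeqCZero :=
  fun A hA => by
    rw [show ContinuousLinearMap.id ℝ SeqCZero '' A = A from Set.image_id A]
    exact hA.isLwcSet_nullSeq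

/-- The part of the duality of `c₀` and `ℓ¹` that lets bounded sequences act on the dual of `c₀`. -/
theorem summable_abs_apply_unitNull (f : NormDual SeqCZero) :
    Summable (fun k => |f (unitNull k)|) ∧ ∑' k, |f (unitNull k)| ≤ ‖f‖ := by
  have hs : ∀ s : Finset ℕ, ∑ k ∈ s, |f (unitNull k)| ≤ ‖f‖ := by
    intro s
    have h1 : ∑ k ∈ s, |f (unitNull k)| =
        f (∑ k ∈ s, (SignType.sign (f (unitNull k)) : ℝ) • unitNull k) := by
      simp [map_sum, sign_mul_self]
    rw [h1]
    refine (le_abs_self _).trans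
      ((f.le_opNorm _).trans (mul_le_of_le_one_right (norm_nonneg _) ?_))
    have h2 := norm_sum_sign_indSeq_le s (fun k => {k})
      (fun i j hij => Set.disjoint_singleton.2 hij)
      (fun k => (SignType.sign (f (unitNull k)) : ℝ)) fun k => by
        rcases lt_trichotomy (f (unitNull k)) 0 with h | h | h <;> simp [h]
    rw [Submodule.coe_norm, Submodule.coe_sum]
    exact h2
  have hsum := summable_of_sum_le (fun k => abs_nonneg _) hs
  exact ⟨hsum, hsum.tsum_le_of_sum_le hs⟩

theorem summable_mul_apply_unitNull (b : ℕ →ᵇ ℝ) (f : NormDual SeqCZero) :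
    Summable fun k => b k * f (unitNull k) := by
  refine Summable.of_norm_bounded ((summable_abs_apply_unitNull f).1.mul_left ‖b‖) fun k => ?_
  rw [norm_mul]
  exact mul_le_mul_of_nonneg_right (b.norm_coe_le_norm k) (abs_nonneg _)

/-- The canonical map from bounded sequences into the bidual of `c₀`. -/
def boundedToBidual : (ℕ →ᵇ ℝ) →L[ℝ] NormDual (NormDual SeqCZero) :=
  LinearMap.mkContinuous₂
    (LinearMap.mk₂ ℝ (fun (b : ℕ →ᵇ ℝ) (f : NormDual SeqCZero) => ∑' k, b k * f (unitNull k))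
      (fun b b' f => by
        rw [← (summable_mul_apply_unitNull b f).tsum_add (summable_mul_apply_unitNull b' f)]
        simp [add_mul])
      (fun r b f => by
        rw [smul_eq_mul, ← tsum_mul_left]
        simp [mul_assoc])
      (fun b f f' => by
        rw [← (summable_mul_apply_unitNull b f).tsum_add (summable_mul_apply_unitNull b f')]
        simp [mul_add])
      (fun r b f => by
        rw [smul_eq_mul, ← tsum_mul_left]
        simp [mul_left_comm])) 1
    (fun b f => by
      rw [LinearMap.mk₂_apply, one_mul]
      refine (tsum_of_norm_bounded
        ((summable_abs_apply_unitNull f).1.mul_left ‖b‖).hasSum fun k => ?_).trans ?_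
      · rw [norm_mul]
        exact mul_le_mul_of_nonneg_right (b.norm_coe_le_norm k) (abs_nonneg _)
      · rw [tsum_mul_left]
        exact mul_le_mul_of_nonneg_left (summable_abs_apply_unitNull f).2 (norm_nonneg _))

theorem boundedToBidual_indSeq (k : ℕ) :
    boundedToBidual (indSeq {k}) =
      NormedSpace.inclusionInDoubleDual ℝ SeqCZero (unitNull k) := by
  ext f
  rw [NormedSpace.dual_def]
  change ∑' j, indSeq {k} j * f (unitNull j) = _
  rw [tsum_eq_single k]
  · simp [indSeq_apply]
  · intro j hj
    simp [indSeq_apply, hj]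

/-- `boundedToBidual` carries the unit vectors of `ℓ^∞`, limited by Phillips' lemma, to the
canonical images of those of `c₀`. -/
theorem isBiLimited_range_unitNull : IsBiLimited (Set.range unitNull) := by
  rw [isBiLimited_iff]
  convert isLimited_range_indSeq_singleton.image boundedToBidual using 1
  rw [← Set.range_comp, ← Set.range_comp]
  exact congrArg Set.range (funext fun k => (boundedToBidual_indSeq k).symm)

theorem not_isLwcSet_range_unitNull : ¬ IsLwcSet (Set.range unitNull) :=
  not_isLwcSet_of_disjoint unitNull norm_indSeq_singleton
    (fun _ _ h => Subtype.ext (abs_indSeq_inf_abs_indSeq h))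
    fun n => ⟨unitNull n, ⟨n, rfl⟩, le_rfl⟩

theorem id_notMem_biLLwc_nullSeq :
    ContinuousLinearMap.id ℝ SeqCZero ∉ BiLLwc SeqCZero SeqCZero := fun h => by
  have := h _ isBiLimited_range_unitNull
  rw [show ContinuousLinearMap.id ℝ SeqCZero '' _ = _ from Set.image_id _] at this
  exact not_isLwcSet_range_unitNull this

/-- The constant sequence one. -/
def oneConv : SeqC := ⟨BoundedContinuousFunction.const ℕ 1, 1, tendsto_const_nhds⟩

theorem isLimited_singleton {X : Type*} [NormedAddCommGroup X] [NormedSpace ℝ X] (x : X) :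
    IsLimited {x} := by
  refine ⟨Bornology.isBounded_singleton, fun f hf => ?_⟩
  rw [tendstoUniformlyOn_singleton_iff_tendsto]
  exact isWeakStarNull_iff.1 hf x

theorem not_isLwcSet_singleton_oneConv : ¬ IsLwcSet {oneConv} := by
  refine not_isLwcSet_of_disjoint unitConv norm_indSeq_singleton
    (fun _ _ h => Subtype.ext (abs_indSeq_inf_abs_indSeq h)) fun n => ⟨oneConv, rfl, fun k => ?_⟩
  change |indSeq {n} k| ≤ |1|
  by_cases h : k = n <;> simp [indSeq_apply, h]

theorem id_notMem_lLwc_convSeq : ContinuousLinearMap.id ℝ SeqC ∉ LLwc SeqC SeqC := fun h => by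
  have := h _ (isLimited_singleton oneConv)
  rw [show ContinuousLinearMap.id ℝ SeqC '' _ = _ from Set.image_id _] at this
  exact not_isLwcSet_singleton_oneConv this

theorem exists_limFunctional :
    ∃ l : NormDual SeqC, ∀ x : SeqC, Tendsto x.1 atTop (𝓝 (l x)) := by
  choose l hl using fun x : SeqC => x.2
  obtain ⟨f, hf⟩ := exists_normDual l
    (fun x y => tendsto_nhds_unique (hl (x + y)) ((hl x).add (hl y)))
    (fun r x => tendsto_nhds_unique (hl (r • x)) ((hl x).const_mul r))
    fun x => le_of_tendsto' (hl x).norm fun n => x.1.norm_coe_le_norm n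
  exact ⟨f, fun x => hf x ▸ hl x⟩

theorem IsLimited.isRelativelyWeaklyCompact_convSeq {A : Set SeqC} (hA : IsLimited A) :
    IsRelativelyWeaklyCompact A := by
  obtain ⟨l, hl⟩ := exists_limFunctional
  obtain ⟨r, hr0, hr⟩ := hA.exists_pos_norm_le
  let ev : ℕ → NormDual SeqC := fun n =>
    (BoundedContinuousFunction.evalCLM ℝ n).comp convSeq.subtypeL
  have hev : ∀ n (x : SeqC), ev n x = x.1 n := fun _ _ => rfl
  have hevn : ∀ n (x : SeqC), |ev n x| ≤ ‖x‖ := fun n x => x.1.norm_coe_le_norm n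
  have hln : ∀ x : SeqC, |l x| ≤ ‖x‖ := fun x => le_of_tendsto' (hl x).norm fun n => hevn n x
  refine isRelativelyWeaklyCompact_of_forall_near fun ε hε => ?_
  -- From `N` on, all elements of `A` are within `ε` of their limits. Replacing these tails by the
  -- limits puts them in a compact set of dimension at most `N + 1`.
  obtain ⟨N, hN⟩ := hA.exists_forall_abs_lt (f := fun n => ev n - l) (fun x => by
    have := (hl x).sub_const (l x)
    rw [sub_self] at this
    exact this) hε
  let S : (Fin N → ℝ) × ℝ → SeqC := fun v => ∑ i, v.1 i • unitConv i + v.2 • oneConv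
  refine ⟨S '' Metric.closedBall 0 (2 * r), ?_, fun x hx => ?_⟩
  · exact isCompact_toWeakSpace_image_closedBall _ _ _
  · refine ⟨_, ⟨(fun i => ev i x - l x, l x), ?_, rfl⟩, ?_⟩
    · have hx' := hr x hx
      rw [mem_closedBall_zero_iff, norm_prod_le_iff, pi_norm_le_iff_of_nonneg (by positivity)]
      refine ⟨fun i => (norm_sub_le _ _).trans ?_, ?_⟩
      · rw [Real.norm_eq_abs, Real.norm_eq_abs]
        linarith [hevn i x, hln x]
      · rw [Real.norm_eq_abs]
        linarith [hln x]
    · refine (BoundedContinuousFunction.norm_le hε.le).2 fun k => ?_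
      have hval : ev k (S (fun i => ev i x - l x, l x)) =
          ∑ i : Fin N, (ev i x - l x) * indSeq {(i : ℕ)} k + l x := by
        simp only [S, hev]
        simp [unitConv, oneConv]
      change |x.1 k - ev k (S _)| ≤ ε
      rw [hval, ← hev k x]
      by_cases hk : k < N
      · rw [Finset.sum_eq_single_of_mem (⟨k, hk⟩ : Fin N) (Finset.mem_univ _)]
        · simp [indSeq_apply, hε.le]
        · intro j _ hj
          have : k ≠ j := fun h => hj (Fin.ext h.symm)
          simp [indSeq_apply, this]
      · rw [Finset.sum_eq_zero]
        · rw [zero_add]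
          exact (hN k (not_lt.1 hk) x hx).le
        · intro j _
          have : k ≠ j := fun h => hk (h ▸ j.2)
          simp [indSeq_apply, this]

theorem id_mem_bd_convSeq : ContinuousLinearMap.id ℝ SeqC ∈ BD SeqC SeqC :=
  fun A hA => by
    rw [show ContinuousLinearMap.id ℝ SeqC '' A = A from Set.image_id A]
    exact hA.isRelativelyWeaklyCompact_convSeq

end NullAndConvergent

/-! ### Transfer to direct sums -/

section SolidEmbeddings

variable {E F G : Type*} [NormedAddCommGroup E] [NormedSpace ℝ E] [Lattice E] [BanachLattice E]
  [NormedAddCommGroup F] [NormedSpace ℝ F] [Lattice F] [BanachLattice F]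
  [NormedAddCommGroup G] [NormedSpace ℝ G] [Lattice G] [BanachLattice G]

/-- An isometric lattice embedding whose range is solid. -/
structure IsSolidEmbedding (i : F →L[ℝ] E) : Prop where
  norm_map : ∀ x, ‖i x‖ = ‖x‖
  map_abs : ∀ x, i |x| = |i x|
  map_inf : ∀ x y, i (x ⊓ y) = i x ⊓ i y
  exists_of_abs_le : ∀ x b, |b| ≤ |i x| → ∃ y, i y = b

omit [BanachLattice F] [BanachLattice E] in
theorem IsSolidEmbedding.injective {i : F →L[ℝ] E} (hi : IsSolidEmbedding i) :
    Function.Injective i := by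
  refine (injective_iff_map_eq_zero i).2 fun x hx => ?_
  rw [← norm_eq_zero, ← hi.norm_map, hx, norm_zero]

omit [BanachLattice F] [BanachLattice E] in
theorem IsSolidEmbedding.le_iff {i : F →L[ℝ] E} (hi : IsSolidEmbedding i) {x y : F} :
    i x ≤ i y ↔ x ≤ y := by
  rw [← inf_eq_left, ← hi.map_inf, hi.injective.eq_iff, inf_eq_left]

omit [BanachLattice E] [BanachLattice F] [BanachLattice G] in
theorem IsSolidEmbedding.comp {i : F →L[ℝ] E} {j : G →L[ℝ] F} (hi : IsSolidEmbedding i)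
    (hj : IsSolidEmbedding j) : IsSolidEmbedding (i.comp j) where
  norm_map x := (hi.norm_map _).trans (hj.norm_map x)
  map_abs x := (congrArg i (hj.map_abs x)).trans (hi.map_abs _)
  map_inf x y := (congrArg i (hj.map_inf x y)).trans (hi.map_inf _ _)
  exists_of_abs_le x b hb := by
    obtain ⟨y, rfl⟩ := hi.exists_of_abs_le _ b hb
    rw [← hi.map_abs, ContinuousLinearMap.comp_apply, ← hi.map_abs, hi.le_iff] at hb
    obtain ⟨z, rfl⟩ := hj.exists_of_abs_le _ y hb
    exact ⟨z, rfl⟩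

omit [BanachLattice E] in
theorem isSolidEmbedding_inl : IsSolidEmbedding (ContinuousLinearMap.inl ℝ E F) where
  norm_map x := by simp [Prod.norm_def]
  map_abs x := Prod.ext rfl (abs_zero (α := F)).symm
  map_inf x y := Prod.ext rfl (inf_idem (0 : F)).symm
  exists_of_abs_le x b hb := by
    refine ⟨b.1, Prod.ext rfl ?_⟩
    have h : |b.2| ≤ |(0 : F)| := hb.2
    rw [abs_zero] at h
    have := norm_le_norm_of_abs_le_abs (h.trans (abs_zero (α := F)).ge)
    simpa [eq_comm] using this

omit [BanachLattice F] in
theorem isSolidEmbedding_inr : IsSolidEmbedding (ContinuousLinearMap.inr ℝ E F) where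
  norm_map x := by simp [Prod.norm_def]
  map_abs x := Prod.ext (abs_zero (α := E)).symm rfl
  map_inf x y := Prod.ext (inf_idem (0 : E)).symm rfl
  exists_of_abs_le x b hb := by
    refine ⟨b.2, Prod.ext ?_ rfl⟩
    have h : |b.1| ≤ |(0 : E)| := hb.1
    rw [abs_zero] at h
    have := norm_le_norm_of_abs_le_abs (h.trans (abs_zero (α := E)).ge)
    simpa [eq_comm] using this

omit [BanachLattice F] [BanachLattice E] in
-- Solidity of the range ensures that the solid hull of `i '' A` adds nothing outside the range of
-- `i`.
theorem IsSolidEmbedding.isLwcSet_image_iff {i : F →L[ℝ] E} (hi : IsSolidEmbedding i)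
    {A : Set F} : IsLwcSet (i '' A) ↔ IsLwcSet A := by
  have hinf0 : ∀ x y : F, |i x| ⊓ |i y| = 0 ↔ |x| ⊓ |y| = 0 := fun x y => by
    rw [← hi.map_abs, ← hi.map_abs, ← hi.map_inf, map_eq_zero_iff i hi.injective]
  have habs : ∀ x y : F, |i x| ≤ |i y| ↔ |x| ≤ |y| := fun x y => by
    rw [← hi.map_abs, ← hi.map_abs, hi.le_iff]
  refine ⟨fun h a ha hd => ?_, fun h a ha hd => ?_⟩
  · have := h (fun n => i (a n)) (fun n => ?_) fun m n hmn => (hinf0 _ _).2 (hd m n hmn)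
    · rw [tendsto_zero_iff_norm_tendsto_zero] at this ⊢
      simpa only [hi.norm_map] using this
    · obtain ⟨x, hx, hax⟩ := ha n
      exact ⟨i x, ⟨x, hx, rfl⟩, (habs _ _).2 hax⟩
  · have hb : ∀ n, ∃ b, i b = a n ∧ b ∈ LatticeOrderedAddCommGroup.solidClosure A := by
      intro n
      obtain ⟨_, ⟨x, hx, rfl⟩, hax⟩ := ha n
      obtain ⟨b, hb⟩ := hi.exists_of_abs_le x _ hax
      rw [← hb] at hax
      exact ⟨b, hb, x, hx, (habs _ _).1 hax⟩
    choose b hba hb using hb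
    obtain rfl : (fun n => i (b n)) = a := funext hba
    have := (i.continuous.tendsto 0).comp (h b hb fun m n hmn => (hinf0 _ _).1 (hd m n hmn))
    rwa [map_zero] at this

theorem IsRelativelyWeaklyCompact.image {X Y : Type*} [NormedAddCommGroup X] [NormedSpace ℝ X]
    [NormedAddCommGroup Y] [NormedSpace ℝ Y] {A : Set X} (hA : IsRelativelyWeaklyCompact A)
    (T : X →L[ℝ] Y) : IsRelativelyWeaklyCompact (T '' A) := by
  refine (IsCompact.image hA (WeakSpace.map T).continuous).closure_of_subset ?_
  rintro _ ⟨_, ⟨x, hx, rfl⟩, rfl⟩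
  exact ⟨toWeakSpace ℝ X x, subset_closure ⟨x, hx, rfl⟩, rfl⟩

section Retract

variable {i : F →L[ℝ] E} {p : E →L[ℝ] F}

/-- Here and below, the projection `i ∘ p` of `E` is compared with the identity of the summand `F`;
`i` is isometric, so the ball of `F` lands in that of `E`. -/
theorem lwc_id_of_retract (hi : IsSolidEmbedding i) (hpi : ∀ x, p (i x) = x)
    (h : i.comp p ∈ Lwc E E) : ContinuousLinearMap.id ℝ F ∈ Lwc F F := by
  refine hi.isLwcSet_image_iff.1 (IsLwcSet.mono h ?_)
  rintro _ ⟨_, ⟨x, hx, rfl⟩, rfl⟩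
  refine ⟨i x, ?_, congrArg i (hpi x)⟩
  rwa [mem_closedBall_zero_iff, hi.norm_map, ← mem_closedBall_zero_iff]

omit [Lattice E] [BanachLattice E] [Lattice F] [BanachLattice F] in
theorem comp_image_image (hpi : ∀ x, p (i x) = x) (A : Set F) :
    i.comp p '' (i '' A) = i '' (ContinuousLinearMap.id ℝ F '' A) := by
  simp [Set.image_image, hpi]

theorem biLLwc_id_of_retract (hi : IsSolidEmbedding i) (hpi : ∀ x, p (i x) = x)
    (h : i.comp p ∈ BiLLwc E E) : ContinuousLinearMap.id ℝ F ∈ BiLLwc F F := fun A hA => by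
  have := h _ (hA.image i)
  rwa [comp_image_image hpi, hi.isLwcSet_image_iff] at this

theorem lLwc_id_of_retract (hi : IsSolidEmbedding i) (hpi : ∀ x, p (i x) = x)
    (h : i.comp p ∈ LLwc E E) : ContinuousLinearMap.id ℝ F ∈ LLwc F F := fun A hA => by
  have := h _ (hA.image i)
  rwa [comp_image_image hpi, hi.isLwcSet_image_iff] at this

omit [Lattice E] [BanachLattice E] [Lattice F] [BanachLattice F] in
theorem comp_image (A : Set E) :
    i.comp p '' A = i '' (ContinuousLinearMap.id ℝ F '' (p '' A)) := by
  simp only [Set.image_image]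
  rfl

theorem comp_mem_biLLwc (hi : IsSolidEmbedding i)
    (h : ContinuousLinearMap.id ℝ F ∈ BiLLwc F F) : i.comp p ∈ BiLLwc E E := fun A hA => by
  rw [comp_image, hi.isLwcSet_image_iff]
  exact h _ (hA.image p)

theorem comp_mem_lLwc (hi : IsSolidEmbedding i)
    (h : ContinuousLinearMap.id ℝ F ∈ LLwc F F) : i.comp p ∈ LLwc E E := fun A hA => by
  rw [comp_image, hi.isLwcSet_image_iff]
  exact h _ (hA.image p)

omit [Lattice E] [BanachLattice E] [Lattice F] [BanachLattice F] in
theorem comp_mem_bd (h : ContinuousLinearMap.id ℝ F ∈ BD F F) : i.comp p ∈ BD E E :=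
  fun A hA => by
    rw [comp_image]
    exact (h _ (hA.image p)).image i

end Retract

/-- Each strict inclusion is witnessed by the projection onto the summand whose identity separates
the two classes. -/
theorem ssubset_classes_prod
    (hE : ContinuousLinearMap.id ℝ E ∈ BiLLwc E E \ Lwc E E)
    (hF : ContinuousLinearMap.id ℝ F ∈ LLwc F F \ BiLLwc F F)
    (hG : ContinuousLinearMap.id ℝ G ∈ BD G G \ LLwc G G) :
    Lwc (E × F × G) (E × F × G) ⊂ BiLLwc (E × F × G) (E × F × G) ∧
      BiLLwc (E × F × G) (E × F × G) ⊂ LLwc (E × F × G) (E × F × G) ∧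
      LLwc (E × F × G) (E × F × G) ⊂ BD (E × F × G) (E × F × G) := by
  let i₂ := (ContinuousLinearMap.inr ℝ E (F × G)).comp (ContinuousLinearMap.inl ℝ F G)
  let i₃ := (ContinuousLinearMap.inr ℝ E (F × G)).comp (ContinuousLinearMap.inr ℝ F G)
  let p₂ := (ContinuousLinearMap.fst ℝ F G).comp (ContinuousLinearMap.snd ℝ E (F × G))
  let p₃ := (ContinuousLinearMap.snd ℝ F G).comp (ContinuousLinearMap.snd ℝ E (F × G))
  have h₁ : IsSolidEmbedding (ContinuousLinearMap.inl ℝ E (F × G)) := isSolidEmbedding_inl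
  have h₂ : IsSolidEmbedding i₂ := isSolidEmbedding_inr.comp isSolidEmbedding_inl
  have h₃ : IsSolidEmbedding i₃ := isSolidEmbedding_inr.comp isSolidEmbedding_inr
  refine ⟨Set.ssubset_iff_exists.2 ⟨lwc_subset_biLLwc, ?_⟩,
    Set.ssubset_iff_exists.2 ⟨biLLwc_subset_lLwc, ?_⟩,
    Set.ssubset_iff_exists.2 ⟨lLwc_subset_bd, ?_⟩⟩
  · exact ⟨(ContinuousLinearMap.inl ℝ E (F × G)).comp (ContinuousLinearMap.fst ℝ E (F × G)),
      comp_mem_biLLwc h₁ hE.1, fun h => hE.2 (lwc_id_of_retract h₁ (fun _ => rfl) h)⟩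
  · exact ⟨i₂.comp p₂, comp_mem_lLwc h₂ hF.1,
      fun h => hF.2 (biLLwc_id_of_retract h₂ (fun _ => rfl) h)⟩
  · exact ⟨i₃.comp p₃, comp_mem_bd hG.1,
      fun h => hG.2 (lLwc_id_of_retract h₃ (fun _ => rfl) h)⟩

end SolidEmbeddings

end LimitedlyLwc

end

open LimitedlyLwc in
theorem mainTheorem7 :
    (∀ (X F : Type*) [NormedAddCommGroup X] [NormedSpace ℝ X] [CompleteSpace X]
        [NormedAddCommGroup F] [NormedSpace ℝ F] [Lattice F] [BanachLattice F],
      Lwc X F ⊆ BiLLwc X F ∧ BiLLwc X F ⊆ LLwc X F ∧ LLwc X F ⊆ BD X F) ∧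
    (ContinuousLinearMap.id ℝ EllTwo ∈ BiLLwc EllTwo EllTwo ∧
      ContinuousLinearMap.id ℝ EllTwo ∉ Lwc EllTwo EllTwo) ∧
    (ContinuousLinearMap.id ℝ SeqCZero ∈ LLwc SeqCZero SeqCZero ∧
      ContinuousLinearMap.id ℝ SeqCZero ∉ BiLLwc SeqCZero SeqCZero) ∧
    (ContinuousLinearMap.id ℝ SeqC ∈ BD SeqC SeqC ∧
      ContinuousLinearMap.id ℝ SeqC ∉ LLwc SeqC SeqC) ∧
    (Lwc (EllTwo × SeqCZero × SeqC) (EllTwo × SeqCZero × SeqC) ⊂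
        BiLLwc (EllTwo × SeqCZero × SeqC) (EllTwo × SeqCZero × SeqC) ∧
      BiLLwc (EllTwo × SeqCZero × SeqC) (EllTwo × SeqCZero × SeqC) ⊂
        LLwc (EllTwo × SeqCZero × SeqC) (EllTwo × SeqCZero × SeqC) ∧
      LLwc (EllTwo × SeqCZero × SeqC) (EllTwo × SeqCZero × SeqC) ⊂
        BD (EllTwo × SeqCZero × SeqC) (EllTwo × SeqCZero × SeqC)) := by
  exact ⟨fun X F _ _ _ _ _ _ _ => ⟨lwc_subset_biLLwc, biLLwc_subset_lLwc, lLwc_subset_bd⟩,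
    ⟨id_mem_biLLwc_ellTwo, id_notMem_lwc_ellTwo⟩,
    ⟨id_mem_lLwc_nullSeq, id_notMem_biLLwc_nullSeq⟩,
    ⟨id_mem_bd_convSeq, id_notMem_lLwc_convSeq⟩,
    ssubset_classes_prod ⟨id_mem_biLLwc_ellTwo, id_notMem_lwc_ellTwo⟩
      ⟨id_mem_lLwc_nullSeq, id_notMem_biLLwc_nullSeq⟩
      ⟨id_mem_bd_convSeq, id_notMem_lLwc_convSeq⟩⟩
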